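/- For real $\alpha>0$ and $\gamma>0$, a sequence $\{x_j\}_{j=0}^{\infty}$ of real numbers is called a discrete $(\alpha,\gamma)$-neighbourhood of zero if there is an integer $N\ge 1$ such that $|x_j|=\dfrac{\pi}{\gamma^{\alpha+1}(N+j)^{\alpha}}$ for all integers $j\ge 0$. Let $\{c_k\}_{k=1}^{\infty}$ be a nonincreasing sequence of nonnegative real numbers, and for $\alpha>0$ consider the series $$\sum_{k=1}^{\infty}c_k\sin (k^{\alpha}x).\qquad(1)$$ (a) Let $\alpha$ be an even positive integer, and let $X\subseteq\mathbb{R}$ be any set containing a point of the form $\frac{\pi}{2}+2\pi m$ or $\frac{2\pi}{3}+2\pi m$ with $m\in\mathbb{Z}$. Then the series (1) converges uniformly on $X$ if and only if $\sum_{k=1}^{\infty}c_k<\infty$. (b) Let $\alpha$ be an odd positive integer, and let $X\subseteq\mathbb{R}$ be any set containing, for some real $\gamma\ge 2$, all terms of a discrete $(\alpha,\gamma)$-neighbourhood of zero. Then the series (1) converges uniformly on $X$ if and only if $c_kk\to 0$ as $k\to\infty$. (c) Let $\alpha\in(0,2)$ be real, and let $X\subseteq\mathbb{R}$ be any bounded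 set containing, for some real $\gamma\ge 2$, all terms of a discrete $(\alpha,\gamma)$-neighbourhood of zero. Then the series (1) converges uniformly on $X$ if and only if $c_kk\to 0$ as $k\to\infty$. -/

import Mathlib

/-- The partial sum `∑_{k=1}^{n} c_k sin (k^α x)`; the value `c 0` is never used. -/
noncomputable def sinePartialSum (c : ℕ → ℝ) (α : ℝ) (n : ℕ) (x : ℝ) : ℝ :=
  ∑ k ∈ Finset.Icc 1 n, c k * Real.sin ((k : ℝ) ^ α * x)

/-- The series `∑_{k ≥ 1} c_k sin (k^α x)` converges uniformly on `X`. -/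
def SineSeriesConvergesUniformlyOn (c : ℕ → ℝ) (α : ℝ) (X : Set ℝ) : Prop :=
  ∃ S : ℝ → ℝ, TendstoUniformlyOn (sinePartialSum c α) S Filter.atTop X

/-- The sequence `x_0, x_1, …` is a discrete `(α, γ)`-neighbourhood of zero
(used for `α > 0` and `γ > 0`). The signs of the `x_j` are arbitrary. -/
def IsDiscreteNeighbourhoodOfZero (α γ : ℝ) (x : ℕ → ℝ) : Prop :=
  ∃ N : ℕ, 1 ≤ N ∧ ∀ j : ℕ, |x j| = Real.pi / (γ ^ (α + 1) * ((N : ℝ) + (j : ℝ)) ^ α)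

/-- The set `X` contains, for some `γ ≥ 2`, a discrete `(α, γ)`-neighbourhood of zero. -/
def ContainsDiscreteNeighbourhoodOfZero (α : ℝ) (X : Set ℝ) : Prop :=
  ∃ γ : ℝ, 2 ≤ γ ∧ ∃ x : ℕ → ℝ, IsDiscreteNeighbourhoodOfZero α γ x ∧ ∀ j : ℕ, x j ∈ X

/-! Sufficiency of `c k * k → 0` rests on dyadic blocks. If the sine sums over subintervals of
`[2^j, 2^(j+1)]` are at most `σ j * 2^j`, Abel summation bounds a tail of the series by `sup (c k *
k)` times `∑ σ j`. It is therefore enough to bound `∑ σ j` uniformly in `x`; a bound on each `σ j`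
alone would lose a logarithm.

For odd `n`, put `θ = x / 2π`. Weyl's inequality, read backwards
(`exists_rational_approx_of_large_weyl_sum`), says that `σ j` can be large only if `θ` is close at
scale `2^j` to a rational `r` of small denominator. Since `k^n` is odd in `k`, complete sine sums at
rationals vanish (`abs_sum_sin_rational_le`), so `σ j` is also small when `θ` is too close to `r`.
Each `r` thus matters only at scales with `|θ - r| * 2^(jn)` near `1`, with geometric decay on both
sides and a power saving in the denominator. Only one `r` occurs for each dyadic size of denominator
(`eq_of_dyadic_approx`), so everything sums to a constant, for all real `x`.

For real `α < 2`, `α ≠ 1`, the van der Corput second derivative test plays the role of Weyl's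
inequality and `0` is the only relevant rational. Boundedness of `x` controls the extra term of that
test.

Necessity: at the point of the neighbourhood indexed by `M`, the phases with `M < k ≤ 2M` all lie in
one quarter period away from `0`, so the block is at least a constant times `M * c (2M)`. For even
exponents the prescribed points make all sines nonnegative, and at least `1/2` for one index in
every six, which forces `∑ c k < ∞`. -/

section UniformConvergence

open Finset

/-- `σ` controls the sums `∑ sin (k ^ α x)` over subintervals of dyadic blocks. -/
def DyadicSineBound (α x : ℝ) (σ : ℕ → ℝ) : Prop :=
  ∀ j a b : ℕ, 2 ^ j ≤ a → a ≤ b → b ≤ 2 ^ (j + 1) →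
    |∑ k ∈ Ico a b, Real.sin ((k : ℝ) ^ α * x)| ≤ σ j * 2 ^ j

/-! ### Abel summation over dyadic blocks and criteria for uniform convergence. -/

theorem DyadicSineBound.nonneg {α x : ℝ} {σ : ℕ → ℝ} (h : DyadicSineBound α x σ) (j : ℕ) :
    0 ≤ σ j := by
  have := h j (2 ^ j) (2 ^ j) le_rfl le_rfl (Nat.pow_le_pow_right (by norm_num) (by omega))
  have h2 : (0 : ℝ) < 2 ^ j := by positivity
  simp at this
  nlinarith

theorem antitone_from_one {c : ℕ → ℝ} (hanti : ∀ k : ℕ, 1 ≤ k → c (k + 1) ≤ c k)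
    {a b : ℕ} (ha : 1 ≤ a) (hab : a ≤ b) : c b ≤ c a := by
  induction b, hab using Nat.le_induction with
  | base => exact le_rfl
  | succ n hn ih => exact (hanti n (ha.trans hn)).trans ih

/-- Abel's inequality: the weights `c k - c (k + 1)` and the last `c b` are nonnegative and add up
to `c a`. -/
theorem abs_sum_mul_le_of_antitone {c s : ℕ → ℝ} {a : ℕ} {M : ℝ}
    (hnonneg : ∀ k, a ≤ k → 0 ≤ c k) (hanti : ∀ k, a ≤ k → c (k + 1) ≤ c k) {b : ℕ} (hab : a ≤ b)
    (hM : ∀ b', a ≤ b' → b' ≤ b → |∑ k ∈ Ico a b', s k| ≤ M) :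
    |∑ k ∈ Ico a b, c k * s k| ≤ c a * M := by
  have key : ∀ b', a ≤ b' → b' ≤ b →
      |∑ k ∈ Ico a b', c k * s k - c b' * ∑ k ∈ Ico a b', s k| ≤ (c a - c b') * M := by
    intro b' hb'
    induction b', hb' using Nat.le_induction with
    | base => simp
    | succ n hn ih =>
      intro hnb
      have h1 := ih (by omega)
      have h2 := hM (n + 1) (by omega) hnb
      have h3 : ∑ k ∈ Ico a (n + 1), c k * s k - c (n + 1) * ∑ k ∈ Ico a (n + 1), s k
          = (∑ k ∈ Ico a n, c k * s k - c n * ∑ k ∈ Ico a n, s k)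
            + (c n - c (n + 1)) * ∑ k ∈ Ico a (n + 1), s k := by
        rw [sum_Ico_succ_top hn, sum_Ico_succ_top hn]; ring
      rw [h3]
      have h4 := hanti n hn
      calc _ ≤ _ := abs_add_le _ _
        _ ≤ (c a - c n) * M + (c n - c (n + 1)) * M := by
          rw [abs_mul, abs_of_nonneg (by linarith : 0 ≤ c n - c (n + 1))]
          gcongr
        _ = _ := by ring
  have h1 := key b hab le_rfl
  have h2 := hM b hab le_rfl
  have h3 := hnonneg b hab
  calc |∑ k ∈ Ico a b, c k * s k|
      = |(∑ k ∈ Ico a b, c k * s k - c b * ∑ k ∈ Ico a b, s k) + c b * ∑ k ∈ Ico a b, s k| := by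
        ring_nf
    _ ≤ _ := abs_add_le _ _
    _ ≤ (c a - c b) * M + c b * M := by
      rw [abs_mul (c b), abs_of_nonneg h3]; gcongr
    _ = _ := by ring

/-- On a block starting at `a ≥ 2^j`, Abel's inequality gives `c a * 2^j * σ j ≤ (c a * a) * σ j ≤ ε
* σ j`; the blocks are then added up. -/
theorem abs_sum_Ico_le_of_dyadicSineBound {c : ℕ → ℝ} (hnonneg : ∀ k : ℕ, 1 ≤ k → 0 ≤ c k)
    (hanti : ∀ k : ℕ, 1 ≤ k → c (k + 1) ≤ c k) {α x : ℝ} {σ : ℕ → ℝ}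
    (hσ : DyadicSineBound α x σ) {ε : ℝ} {m : ℕ} (hm : 1 ≤ m)
    (hε : ∀ k, m ≤ k → c k * k ≤ ε) (J : ℕ) :
    ∀ M, m ≤ M → M ≤ 2 ^ J →
      |∑ k ∈ Ico m M, c k * Real.sin ((k : ℝ) ^ α * x)| ≤ ε * ∑ j ∈ range J, σ j := by
  have block : ∀ j a b, m ≤ a → 2 ^ j ≤ a → a ≤ b → b ≤ 2 ^ (j + 1) →
      |∑ k ∈ Ico a b, c k * Real.sin ((k : ℝ) ^ α * x)| ≤ ε * σ j := by
    intro j a b hma hja hab hbj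
    have h1 := abs_sum_mul_le_of_antitone (c := c) (s := fun k => Real.sin ((k : ℝ) ^ α * x))
      (a := a) (M := σ j * 2 ^ j) (fun k hk => hnonneg k (by omega))
      (fun k hk => hanti k (by omega)) hab (fun b' h1 h2 => hσ j a b' hja h1 (h2.trans hbj))
    refine h1.trans ?_
    have h2 : (2 : ℝ) ^ j ≤ a := by exact_mod_cast hja
    have h3 := hnonneg a (by omega)
    have h4 := hε a hma
    have h5 := hσ.nonneg j
    calc c a * (σ j * 2 ^ j) = (c a * 2 ^ j) * σ j := by ring
      _ ≤ (c a * a) * σ j := by gcongr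
      _ ≤ ε * σ j := by gcongr
  have hε0 : 0 ≤ ε := (mul_nonneg (hnonneg m hm) (Nat.cast_nonneg m)).trans (hε m le_rfl)
  induction J with
  | zero =>
    intro M h1 h2
    have : m = M := by simp at h2; omega
    subst this; simp
  | succ J ih =>
    intro M h1 h2
    rw [sum_range_succ, mul_add]
    have h0 := mul_nonneg hε0 (hσ.nonneg J)
    by_cases h3 : M ≤ 2 ^ J
    · have := ih M h1 h3
      linarith
    push Not at h3
    by_cases h4 : 2 ^ J ≤ m
    · have := block J m M le_rfl h4 h1 h2
      have h5 : 0 ≤ ε * ∑ j ∈ range J, σ j := mul_nonneg hε0 (sum_nonneg fun j _ => hσ.nonneg j)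
      linarith
    push Not at h4
    have h5 := ih (2 ^ J) h4.le le_rfl
    have h6 := block J (2 ^ J) M h4.le le_rfl h3.le h2
    rw [← sum_Ico_consecutive _ h4.le h3.le]
    exact (abs_add_le _ _).trans (add_le_add h5 h6)

theorem sinePartialSum_sub (c : ℕ → ℝ) (α : ℝ) {m n : ℕ} (h : m ≤ n) (x : ℝ) :
    sinePartialSum c α n x - sinePartialSum c α m x
      = ∑ k ∈ Ico (m + 1) (n + 1), c k * Real.sin ((k : ℝ) ^ α * x) := by
  have e : ∀ n : ℕ, Icc 1 n = Ico 1 (n + 1) := fun n => by ext; simp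
  simp only [sinePartialSum, e]
  rw [← sum_Ico_consecutive _ (by omega : 1 ≤ m + 1) (by omega : m + 1 ≤ n + 1)]
  ring

theorem convergesUniformlyOn_of_abs_sum_Ico_le {c : ℕ → ℝ} {α : ℝ} {X : Set ℝ}
    (h : ∀ ε > 0, ∃ m₀, ∀ m n, m₀ ≤ m → m ≤ n → ∀ x ∈ X,
      |∑ k ∈ Ico (m + 1) (n + 1), c k * Real.sin ((k : ℝ) ^ α * x)| ≤ ε) :
    SineSeriesConvergesUniformlyOn c α X := by
  have hC : UniformCauchySeqOn (sinePartialSum c α) Filter.atTop X := by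
    rw [Metric.uniformCauchySeqOn_iff]
    intro ε hε
    obtain ⟨m₀, hm⟩ := h (ε / 2) (by linarith)
    refine ⟨m₀, fun m hm1 n hn1 x hx => ?_⟩
    rcases le_total m n with hmn | hmn
    · rw [dist_comm, Real.dist_eq, sinePartialSum_sub c α hmn]
      linarith [hm m n hm1 hmn x hx]
    · rw [Real.dist_eq, sinePartialSum_sub c α hmn]
      linarith [hm n m hn1 hmn x hx]
  have hp : ∀ x : ℝ, ∃ l, x ∈ X →
      Filter.Tendsto (fun n => sinePartialSum c α n x) Filter.atTop (nhds l) := by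
    intro x
    by_cases hx : x ∈ X
    · obtain ⟨l, hl⟩ := cauchySeq_tendsto_of_complete (hC.cauchySeq hx)
      exact ⟨l, fun _ => hl⟩
    -- Off `X` the limit function is irrelevant and gets the value `0`.
    · exact ⟨0, fun h => absurd h hx⟩
  choose S hS using hp
  exact ⟨S, hC.tendstoUniformlyOn_of_tendsto fun x hx => hS x hx⟩

theorem convergesUniformlyOn_of_dyadicSineBound {c : ℕ → ℝ} (hnonneg : ∀ k : ℕ, 1 ≤ k → 0 ≤ c k)
    (hanti : ∀ k : ℕ, 1 ≤ k → c (k + 1) ≤ c k) {α : ℝ} {X : Set ℝ} {A : ℝ}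
    (hX : ∀ x ∈ X, ∃ σ, DyadicSineBound α x σ ∧ ∀ J, ∑ j ∈ range J, σ j ≤ A)
    (hc : Filter.Tendsto (fun k : ℕ => c k * (k : ℝ)) Filter.atTop (nhds 0)) :
    SineSeriesConvergesUniformlyOn c α X := by
  apply convergesUniformlyOn_of_abs_sum_Ico_le
  intro ε hε
  have hA : 0 < |A| + 1 := by positivity
  obtain ⟨m₀, hm₀⟩ := Filter.eventually_atTop.1
    (hc.eventually (gt_mem_nhds (div_pos hε hA)))
  refine ⟨m₀, fun m n hm hmn x hx => ?_⟩
  obtain ⟨σ, hσ, hA'⟩ := hX x hx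
  refine (abs_sum_Ico_le_of_dyadicSineBound hnonneg hanti hσ (ε := ε / (|A| + 1)) (by omega)
    (fun k hk => (hm₀ k (by omega)).le) (n + 1) (n + 1) (by omega)
    Nat.lt_two_pow_self.le).trans ?_
  have h1 : ∑ j ∈ range (n + 1), σ j ≤ |A| + 1 := by linarith [hA' (n + 1), le_abs_self A]
  calc _ ≤ ε / (|A| + 1) * (|A| + 1) := by gcongr
    _ = ε := by field_simp

/-! ### Necessity of `c k * k → 0`. -/

theorem tendsto_of_convergesUniformlyOn {c : ℕ → ℝ} (hnonneg : ∀ k : ℕ, 1 ≤ k → 0 ≤ c k)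
    (hanti : ∀ k : ℕ, 1 ≤ k → c (k + 1) ≤ c k) {α : ℝ} (hα : 0 < α) {X : Set ℝ}
    (hX : ContainsDiscreteNeighbourhoodOfZero α X) (h : SineSeriesConvergesUniformlyOn c α X) :
    Filter.Tendsto (fun k : ℕ => c k * (k : ℝ)) Filter.atTop (nhds 0) := by
  obtain ⟨γ, hγ, x, ⟨N, hN, hx⟩, hxX⟩ := hX
  obtain ⟨S, hS⟩ := h
  have hC := hS.uniformCauchySeqOn
  rw [Metric.uniformCauchySeqOn_iff] at hC
  have hγ0 : (0 : ℝ) < γ := by linarith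
  have hγp : 0 < γ ^ (α + 1) := Real.rpow_pos_of_pos hγ0 _
  set η := Real.sin (Real.pi / γ ^ (α + 1)) with hη
  have hle : Real.pi / γ ^ (α + 1) ≤ Real.pi / 2 := by
    gcongr
    calc (2 : ℝ) ≤ γ := hγ
      _ = γ ^ (1 : ℝ) := (Real.rpow_one _).symm
      _ ≤ γ ^ (α + 1) := Real.rpow_le_rpow_of_exponent_le (by linarith) (by linarith)
  have hη0 : 0 < η := Real.sin_pos_of_pos_of_lt_pi (by positivity)
    (by linarith [Real.pi_pos])
  rw [Metric.tendsto_atTop]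
  intro ε hε
  obtain ⟨m₀, hm₀⟩ := hC (ε * η / 4) (by positivity)
  refine ⟨2 * (m₀ + N) + 2, fun k hk => ?_⟩
  -- The block `(M, 2M]` with `M = ⌊k/2⌋` is tested at the point `x j` with `N + j = M`; its indices
  -- are at most `k`, so its coefficients are at least `c k`.
  obtain ⟨M, hM⟩ : ∃ M, M = k / 2 := ⟨_, rfl⟩
  have hMN : N ≤ M := by omega
  obtain ⟨j, rfl⟩ := Nat.exists_eq_add_of_le hMN
  have h1 := hm₀ (2 * (N + j)) (by omega) (N + j) (by omega) (x j) (hxX j)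
  rw [Real.dist_eq, sinePartialSum_sub c α (by omega)] at h1
  have hMpos : (0 : ℝ) < (N : ℝ) + j := by
    have : (1 : ℝ) ≤ N := by exact_mod_cast hN
    positivity
  -- From `M ≤ i ≤ 2M ≤ γM` the phase lies between `π / γ^(α+1)` and `π / γ ≤ π / 2`, where sine
  -- increases. This is where `γ ≥ 2` enters.
  have hsin : ∀ i ∈ Ico (N + j + 1) (2 * (N + j) + 1), η ≤ Real.sin ((i : ℝ) ^ α * |x j|) := by
    intro i hi
    rw [mem_Ico] at hi
    have hi1 : (N : ℝ) + j ≤ i := by exact_mod_cast (by omega : N + j ≤ i)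
    have hi2 : (i : ℝ) ≤ γ * ((N : ℝ) + j) := by
      have : (i : ℝ) ≤ 2 * ((N : ℝ) + j) := by exact_mod_cast (by omega : i ≤ 2 * (N + j))
      nlinarith
    have hp : 0 < ((N : ℝ) + j) ^ α := Real.rpow_pos_of_pos hMpos _
    have hi3 : ((N : ℝ) + j) ^ α ≤ (i : ℝ) ^ α := Real.rpow_le_rpow hMpos.le hi1 hα.le
    have hi4 : (i : ℝ) ^ α ≤ γ ^ α * ((N : ℝ) + j) ^ α := by
      rw [← Real.mul_rpow hγ0.le hMpos.le]
      exact Real.rpow_le_rpow (by positivity) hi2 hα.le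
    rw [hx j]
    have hpi := Real.pi_pos
    apply Real.sin_le_sin_of_le_of_le_pi_div_two
    · have : 0 < Real.pi / γ ^ (α + 1) := by positivity
      linarith
    · calc (i : ℝ) ^ α * (Real.pi / (γ ^ (α + 1) * ((N : ℝ) + j) ^ α))
          ≤ (γ ^ α * ((N : ℝ) + j) ^ α) * (Real.pi / (γ ^ (α + 1) * ((N : ℝ) + j) ^ α)) := by
            gcongr
        _ = Real.pi / γ := by
            rw [Real.rpow_add hγ0, Real.rpow_one]
            have : 0 < γ ^ α := Real.rpow_pos_of_pos hγ0 _
            field_simp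
        _ ≤ Real.pi / 2 := by gcongr
    · calc Real.pi / γ ^ (α + 1)
          = ((N : ℝ) + j) ^ α * (Real.pi / (γ ^ (α + 1) * ((N : ℝ) + j) ^ α)) := by field_simp
        _ ≤ _ := by gcongr
  have habs : |∑ i ∈ Ico (N + j + 1) (2 * (N + j) + 1), c i * Real.sin ((i : ℝ) ^ α * x j)|
      = |∑ i ∈ Ico (N + j + 1) (2 * (N + j) + 1), c i * Real.sin ((i : ℝ) ^ α * |x j|)| := by
    rcases abs_choice (x j) with h | h <;> rw [h]
    simp [sum_neg_distrib]
  rw [habs] at h1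
  have h2 : ((N : ℝ) + j) * (c k * η)
      ≤ ∑ i ∈ Ico (N + j + 1) (2 * (N + j) + 1), c i * Real.sin ((i : ℝ) ^ α * |x j|) := by
    have : ∑ i ∈ Ico (N + j + 1) (2 * (N + j) + 1), c k * η = ((N : ℝ) + j) * (c k * η) := by
      rw [sum_const, Nat.card_Ico, nsmul_eq_mul]
      congr 1
      rw [show 2 * (N + j) + 1 - (N + j + 1) = N + j by omega]; push_cast; ring
    rw [← this]
    refine sum_le_sum fun i hi => ?_
    have h3 := hsin i hi
    rw [mem_Ico] at hi
    have h4 : c k ≤ c i := antitone_from_one hanti (by omega) (by omega)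
    exact mul_le_mul h4 h3 hη0.le (hnonneg i (by omega))
  have h3 := h2.trans ((le_abs_self _).trans h1.le)
  have hck := hnonneg k (by omega)
  have hk3 : (k : ℝ) ≤ 3 * ((N : ℝ) + j) := by exact_mod_cast (by omega : k ≤ 3 * (N + j))
  rw [Real.dist_eq, sub_zero, abs_of_nonneg (by positivity)]
  have h5 : ((N : ℝ) + j) * c k ≤ ε / 4 := by
    have : ((N : ℝ) + j) * c k * η ≤ ε / 4 * η := by linarith
    exact le_of_mul_le_mul_right this hη0
  nlinarith

/-- Uniformity in `T` is the point: `min t t⁻¹` is dominated by a multiple of the increment of `t /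
(1 + t)` from `t` to `t * R`, which telescopes with total variation at most `1`. -/
theorem sum_min_geometric_le {T R : ℝ} (hT : 0 ≤ T) (hR : 1 < R) (J : ℕ) :
    ∑ j ∈ range J, min (T * R ^ j) (T * R ^ j)⁻¹ ≤ 2 * (1 + R) / (R - 1) := by
  have hR1 : 0 < R - 1 := by linarith
  set K := 2 * (1 + R) / (R - 1) with hK
  have hK0 : 0 < K := by positivity
  have step : ∀ t : ℝ, 0 ≤ t → min t t⁻¹ ≤ K * (t * R / (1 + t * R) - t / (1 + t)) := by
    intro t ht
    have e : K * (t * R / (1 + t * R) - t / (1 + t))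
        = 2 * (1 + R) * t / ((1 + t) * (1 + t * R)) := by
      rw [hK]
      have : 0 < 1 + t * R := by positivity
      field_simp
      ring
    rw [e, le_div_iff₀ (by positivity)]
    rcases le_total t 1 with h | h
    · calc min t t⁻¹ * ((1 + t) * (1 + t * R)) ≤ t * ((1 + 1) * (1 + 1 * R)) := by
            gcongr; exact min_le_left _ _
        _ = _ := by ring
    · have ht0 : 0 < t := by linarith
      calc min t t⁻¹ * ((1 + t) * (1 + t * R)) ≤ t⁻¹ * ((t + t) * (t + t * R)) := by
            gcongr; exact min_le_right _ _
        _ = _ := by field_simp; ring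
  have tele : ∑ j ∈ range J, min (T * R ^ j) (T * R ^ j)⁻¹
      ≤ K * (T * R ^ J / (1 + T * R ^ J) - T / (1 + T)) := by
    induction J with
    | zero => simp
    | succ J ih =>
      rw [sum_range_succ]
      have := step (T * R ^ J) (by positivity)
      rw [pow_succ, ← mul_assoc]
      linarith
  refine tele.trans ?_
  have h1 : T * R ^ J / (1 + T * R ^ J) ≤ 1 := by
    rw [div_le_one (by positivity)]; linarith
  have h2 : 0 ≤ T / (1 + T) := by positivity
  nlinarith

theorem sum_geometric_le {r : ℝ} (h0 : 0 ≤ r) (h1 : r < 1) (J : ℕ) :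
    ∑ j ∈ range J, r ^ j ≤ (1 - r)⁻¹ := by
  rw [← tsum_geometric_of_lt_one h0 h1]
  exact (summable_geometric_of_lt_one h0 h1).sum_le_tsum _ (fun _ _ => by positivity)

/-! ### Even exponents. -/

theorem sin_pow_mul_of_even {n : ℕ} (hn : 0 < n) (he : Even n) {x : ℝ}
    (hx : ∃ m : ℤ, Real.pi / 2 + 2 * Real.pi * (m : ℝ) = x ∨
      2 * Real.pi / 3 + 2 * Real.pi * (m : ℝ) = x) (k : ℕ) :
    0 ≤ Real.sin ((k : ℝ) ^ (n : ℝ) * x) ∧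
      (k % 6 = 1 → 1 / 2 ≤ Real.sin ((k : ℝ) ^ (n : ℝ) * x)) := by
  obtain ⟨r, rfl⟩ := he
  have hr : r ≠ 0 := by omega
  rw [Real.rpow_natCast]
  have hpi := Real.pi_pos
  obtain ⟨m, rfl | rfl⟩ := hx
  -- An even power is `0` or `1` modulo `4`, according to parity, so the sine at `π/2` is `0` or
  -- `1`.
  · obtain ⟨d, hd⟩ : ∃ d, k ^ (r + r) = 4 * d + k % 2 := by
      rcases Nat.even_or_odd' k with ⟨l, rfl | rfl⟩
      · refine ⟨2 ^ (r + r - 2) * l ^ (r + r), ?_⟩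
        rw [mul_pow, ← mul_assoc, show 4 = 2 ^ 2 by norm_num, ← pow_add]
        rw [show 2 + (r + r - 2) = r + r by omega]; simp
      · have h : (2 * l + 1) ^ (r + r) % 4 = 1 := by
          rw [← two_mul, pow_mul, Nat.pow_mod,
            show (2 * l + 1) ^ 2 = 4 * (l * l + l) + 1 by ring]
          simp [Nat.add_mod]
        refine ⟨(2 * l + 1) ^ (r + r) / 4, ?_⟩
        omega
    have h : ((k : ℝ) ^ (r + r)) * (Real.pi / 2 + 2 * Real.pi * (m : ℝ))
        = ((k % 2 : ℕ) : ℝ) * (Real.pi / 2)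
          + ((d + (4 * d + ((k % 2 : ℕ) : ℤ)) * m : ℤ) : ℝ) * (2 * Real.pi) := by
      have : ((k : ℝ) ^ (r + r)) = 4 * d + ((k % 2 : ℕ) : ℝ) := by exact_mod_cast hd
      rw [this]
      generalize k % 2 = e
      push_cast; ring
    rw [h, Real.sin_add_int_mul_two_pi]
    rcases Nat.mod_two_eq_zero_or_one k with h | h <;> rw [h]
    · simp; omega
    · norm_num
  -- An even power is `0` or `1` modulo `3`, so the sine at `2π/3` is `0` or `sin (2π/3) ≥ 1/2`.
  -- Indices congruent to `1` modulo `6` serve both kinds of points.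
  · obtain ⟨d, e, hd, he⟩ : ∃ d e, k ^ (r + r) = 3 * d + e ∧
        ((k % 3 = 0 ∧ e = 0) ∨ (k % 3 ≠ 0 ∧ e = 1)) := by
      rcases eq_or_ne (k % 3) 0 with h0 | h0
      · obtain ⟨l, rfl⟩ := Nat.dvd_of_mod_eq_zero h0
        refine ⟨3 ^ (r + r - 1) * l ^ (r + r), 0, ?_, Or.inl ⟨h0, rfl⟩⟩
        rw [mul_pow, ← mul_assoc, ← pow_succ', show r + r - 1 + 1 = r + r by omega]; simp
      · have h : k ^ (r + r) % 3 = 1 := by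
          have h2 : k ^ 2 % 3 = 1 := by
            have : k % 3 = 1 ∨ k % 3 = 2 := by omega
            rcases this with h | h <;> simp [Nat.pow_mod, h]
          rw [← two_mul, pow_mul, Nat.pow_mod, h2]
          simp
        exact ⟨k ^ (r + r) / 3, 1, by omega, Or.inr ⟨h0, rfl⟩⟩
    have h : ((k : ℝ) ^ (r + r)) * (2 * Real.pi / 3 + 2 * Real.pi * (m : ℝ))
        = (e : ℝ) * (2 * Real.pi / 3)
          + ((d + (3 * d + e) * m : ℤ) : ℝ) * (2 * Real.pi) := by
      have : ((k : ℝ) ^ (r + r)) = 3 * d + e := by exact_mod_cast hd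
      rw [this]; push_cast; ring
    rw [h, Real.sin_add_int_mul_two_pi]
    rcases he with ⟨h, rfl⟩ | ⟨h, rfl⟩
    · simp; omega
    · have h2 : 1 / 2 ≤ Real.sin (((1 : ℕ) : ℝ) * (2 * Real.pi / 3)) := by
        rw [Nat.cast_one, one_mul, ← Real.sin_pi_sub, ← Real.sin_pi_div_six]
        apply Real.sin_le_sin_of_le_of_le_pi_div_two <;> linarith
      exact ⟨by linarith, fun _ => h2⟩

theorem summable_of_convergesUniformlyOn_even {c : ℕ → ℝ}
    (hnonneg : ∀ k : ℕ, 1 ≤ k → 0 ≤ c k) (hanti : ∀ k : ℕ, 1 ≤ k → c (k + 1) ≤ c k)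
    {n : ℕ} (hn : 0 < n) (he : Even n) {X : Set ℝ}
    (hX : ∃ m : ℤ, Real.pi / 2 + 2 * Real.pi * (m : ℝ) ∈ X ∨
        2 * Real.pi / 3 + 2 * Real.pi * (m : ℝ) ∈ X)
    (h : SineSeriesConvergesUniformlyOn c (n : ℝ) X) : Summable (fun k : ℕ => c (k + 1)) := by
  obtain ⟨x, hxX, hx⟩ : ∃ x ∈ X, ∃ m : ℤ, Real.pi / 2 + 2 * Real.pi * (m : ℝ) = x ∨
      2 * Real.pi / 3 + 2 * Real.pi * (m : ℝ) = x := by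
    obtain ⟨m, hm | hm⟩ := hX
    exacts [⟨_, hm, m, Or.inl rfl⟩, ⟨_, hm, m, Or.inr rfl⟩]
  have hs := sin_pow_mul_of_even hn he hx
  obtain ⟨S, hS⟩ := h
  have hT := hS.tendsto_at hxX
  have succ : ∀ n' : ℕ, sinePartialSum c n (n' + 1) x
      = sinePartialSum c n n' x + c (n' + 1) * Real.sin (((n' + 1 : ℕ) : ℝ) ^ (n : ℝ) * x) := by
    intro n'
    simp only [sinePartialSum]
    rw [sum_Icc_succ_top (by omega)]
  have le_succ : ∀ n' : ℕ, sinePartialSum c n n' x ≤ sinePartialSum c n (n' + 1) x := by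
    intro n'
    rw [succ]
    linarith [mul_nonneg (hnonneg (n' + 1) (by omega)) (hs (n' + 1)).1]
  have hmono : Monotone fun n' => sinePartialSum c n n' x := monotone_nat_of_le_succ le_succ
  have hle : ∀ n', sinePartialSum c n n' x ≤ S x := fun n' => hmono.ge_of_tendsto hT n'
  -- Six consecutive coefficients are at most `6 * c (6J+1)`, and the term of index `6J+1`
  -- contributes at least half its coefficient: hence `12`.
  have key : ∀ J : ℕ, ∑ k ∈ range (6 * J), c (k + 1) ≤ 12 * sinePartialSum c n (6 * J) x := by
    intro J
    induction J with
    | zero => simp [sinePartialSum]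
    | succ J ih =>
      have e1 : c (6 * J + 1) / 2 ≤ c (6 * J + 1)
          * Real.sin (((6 * J + 1 : ℕ) : ℝ) ^ (n : ℝ) * x) := by
        have := (hs (6 * J + 1)).2 (by omega)
        nlinarith [hnonneg (6 * J + 1) (by omega)]
      have e2 := hmono (show 6 * J + 1 ≤ 6 * (J + 1) by omega)
      have e3 := succ (6 * J)
      have e4 : ∀ i, c (6 * J + i + 1) ≤ c (6 * J + 1) :=
        fun i => antitone_from_one hanti (by omega) (by omega)
      have := e4 1; have := e4 2; have := e4 3; have := e4 4; have := e4 5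
      rw [show 6 * (J + 1) = 6 * J + 1 + 1 + 1 + 1 + 1 + 1 by ring] at e2 ⊢
      simp only [sum_range_succ]
      simp only [add_assoc, Nat.reduceAdd] at *
      linarith
  refine summable_of_sum_range_le (c := 12 * S x) (fun k => hnonneg _ (by omega)) fun J => ?_
  calc ∑ k ∈ range J, c (k + 1) ≤ ∑ k ∈ range (6 * J), c (k + 1) :=
        sum_le_sum_of_subset_of_nonneg (range_mono (by omega))
          fun k _ _ => hnonneg _ (by omega)
    _ ≤ _ := key J
    _ ≤ _ := by linarith [hle (6 * J)]

theorem convergesUniformlyOn_of_summable {c : ℕ → ℝ} (hnonneg : ∀ k : ℕ, 1 ≤ k → 0 ≤ c k)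
    (h : Summable (fun k : ℕ => c (k + 1))) (α : ℝ) (X : Set ℝ) :
    SineSeriesConvergesUniformlyOn c α X := by
  apply convergesUniformlyOn_of_abs_sum_Ico_le
  intro ε hε
  have hC := h.hasSum.tendsto_sum_nat.cauchySeq
  obtain ⟨m₀, hm₀⟩ := Metric.cauchySeq_iff.1 hC ε hε
  refine ⟨m₀, fun m n hm hmn x _ => ?_⟩
  have h1 := hm₀ n (by omega) m hm
  rw [Real.dist_eq, ← sum_Ico_eq_sub _ hmn, sum_Ico_add' c m n 1] at h1
  calc |∑ k ∈ Ico (m + 1) (n + 1), c k * Real.sin ((k : ℝ) ^ α * x)|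
      ≤ ∑ k ∈ Ico (m + 1) (n + 1), |c k * Real.sin ((k : ℝ) ^ α * x)| := abs_sum_le_sum_abs _ _
    _ ≤ ∑ k ∈ Ico (m + 1) (n + 1), c k := by
      refine sum_le_sum fun k hk => ?_
      rw [mem_Ico] at hk
      have h2 := hnonneg k (by omega)
      rw [abs_mul, abs_of_nonneg h2]
      exact mul_le_of_le_one_right h2 (Real.abs_sin_le_one _)
    _ ≤ _ := (le_abs_self _).trans h1.le

end UniformConvergence

/-! ### Weyl sums: large exponential sums force rational approximation. -/

section WeylSums

open Finset Polynomial

/-- The additive character `t ↦ exp (2 π i t)`. -/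
noncomputable def expTwoPi (t : ℝ) : ℂ := Complex.exp ((2 * Real.pi * t : ℝ) * Complex.I)

theorem norm_expTwoPi (t : ℝ) : ‖expTwoPi t‖ = 1 := Complex.norm_exp_ofReal_mul_I _

theorem expTwoPi_add (s t : ℝ) : expTwoPi (s + t) = expTwoPi s * expTwoPi t := by
  rw [expTwoPi, expTwoPi, expTwoPi, ← Complex.exp_add]; congr 1; push_cast; ring

theorem conj_expTwoPi (t : ℝ) : (starRingEnd ℂ) (expTwoPi t) = expTwoPi (-t) := by
  rw [expTwoPi, expTwoPi, ← Complex.exp_conj, map_mul, Complex.conj_ofReal,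
    Complex.conj_I]
  congr 1; push_cast; ring

theorem expTwoPi_intCast (m : ℤ) : expTwoPi m = 1 := by
  rw [expTwoPi, Complex.exp_eq_one_iff]; exact ⟨m, by push_cast; ring⟩

theorem expTwoPi_sub_intCast (t : ℝ) (m : ℤ) : expTwoPi (t - m) = expTwoPi t := by
  have := expTwoPi_add (t - m) m
  rw [expTwoPi_intCast, mul_one, sub_add_cancel] at this
  exact this.symm

theorem expTwoPi_im (t : ℝ) : (expTwoPi t).im = Real.sin (2 * Real.pi * t) := by
  rw [expTwoPi, Complex.exp_ofReal_mul_I_im]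

theorem norm_expTwoPi_sub_one (t : ℝ) : ‖expTwoPi t - 1‖ = 2 * |Real.sin (Real.pi * t)| := by
  have := Complex.norm_exp_I_mul_ofReal_sub_one (2 * Real.pi * t)
  rw [expTwoPi, mul_comm, this, Real.norm_eq_abs, abs_mul, abs_two]
  congr 3; ring

theorem four_mul_abs_sub_round_le (t : ℝ) : 4 * |t - round t| ≤ ‖expTwoPi t - 1‖ := by
  rw [← expTwoPi_sub_intCast t (round t), norm_expTwoPi_sub_one]
  have h := abs_sub_round t
  set η := t - round t
  have hpi := Real.pi_pos
  have h1 := Real.mul_le_sin (x := Real.pi * |η|) (by positivity) (by nlinarith)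
  have h2 : Real.sin (Real.pi * |η|) ≤ |Real.sin (Real.pi * η)| := by
    rcases abs_choice η with h | h <;> rw [h]
    · exact le_abs_self _
    · rw [mul_neg, Real.sin_neg]; exact neg_le_abs _
  have h3 : 2 / Real.pi * (Real.pi * |η|) = 2 * |η| := by field_simp
  linarith

/-- A geometric sum: multiplying by `expTwoPi θ - 1` telescopes it, and that factor has norm at
least four times the distance from `θ` to the nearest integer. -/
theorem norm_sum_expTwoPi_linear_le (c θ : ℝ) (L : ℕ) :
    ‖∑ k ∈ range L, expTwoPi (c + θ * k)‖ * (2 * |θ - round θ|) ≤ 1 := by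
  have h1 : (∑ k ∈ range L, expTwoPi (c + θ * k)) * (expTwoPi θ - 1)
      = expTwoPi (c + θ * L) - expTwoPi c := by
    rw [sum_mul]
    have : ∀ k ∈ range L, expTwoPi (c + θ * k) * (expTwoPi θ - 1)
        = expTwoPi (c + θ * (k + 1 : ℕ)) - expTwoPi (c + θ * k) := by
      intro k _
      rw [mul_sub, ← expTwoPi_add, mul_one]; congr 2; push_cast; ring
    rw [sum_congr rfl this, sum_range_sub (fun k : ℕ => expTwoPi (c + θ * k))]
    simp
  have h2 : ‖∑ k ∈ range L, expTwoPi (c + θ * k)‖ * ‖expTwoPi θ - 1‖ ≤ 2 := by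
    rw [← norm_mul, h1]
    refine (norm_sub_le _ _).trans ?_
    rw [norm_expTwoPi, norm_expTwoPi]; norm_num
  have h3 := four_mul_abs_sub_round_le θ
  nlinarith [norm_nonneg (∑ k ∈ range L, expTwoPi (c + θ * k))]

/-- Weyl differencing: expand the square, keep the pairs `k ≤ l` by symmetry, and group them by `h =
l - k`. -/
theorem norm_sq_sum_le_two_mul_sum_norm_correlation (z : ℕ → ℂ) (L : ℕ) :
    ‖∑ k ∈ range L, z k‖ ^ 2
      ≤ 2 * ∑ h ∈ range L, ‖∑ k ∈ range (L - h), z (k + h) * (starRingEnd ℂ) (z k)‖ := by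
  have h1 : ∀ L : ℕ, ‖∑ k ∈ range L, z k‖ ^ 2
      = 2 * (∑ l ∈ range L, ∑ k ∈ range (l + 1), z l * (starRingEnd ℂ) (z k)).re
        - ∑ k ∈ range L, ‖z k‖ ^ 2 := by
    intro L
    induction L with
    | zero => simp
    | succ L ih =>
      rw [sum_range_succ z, sum_range_succ (fun k => ‖z k‖ ^ 2),
        sum_range_succ (fun l => ∑ k ∈ range (l + 1), z l * (starRingEnd ℂ) (z k)),
        ← mul_sum, ← map_sum, sum_range_succ z]
      generalize ∑ k ∈ range L, z k = S at *
      simp only [Complex.sq_norm, Complex.normSq_apply, Complex.add_re, Complex.add_im,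
        Complex.mul_re, Complex.conj_re, Complex.conj_im] at *
      linarith
  have h2 : ∑ l ∈ range L, ∑ k ∈ range (l + 1), z l * (starRingEnd ℂ) (z k)
      = ∑ h ∈ range L, ∑ k ∈ range (L - h), z (k + h) * (starRingEnd ℂ) (z k) := by
    calc _ = ∑ l ∈ range L, ∑ h ∈ range (l + 1), z l * (starRingEnd ℂ) (z (l - h)) := by
          refine sum_congr rfl fun l _ => ?_
          rw [← sum_range_reflect]; rfl
      _ = ∑ h ∈ range L, ∑ l ∈ Ico h L, z l * (starRingEnd ℂ) (z (l - h)) := by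
          refine sum_comm' fun x y => ?_
          simp only [mem_range, mem_Ico]; omega
      _ = _ := by
          refine sum_congr rfl fun h _ => ?_
          rw [sum_Ico_eq_sum_range]
          refine sum_congr rfl fun k _ => ?_
          rw [add_comm h k, Nat.add_sub_cancel]
  rw [h1, h2]
  have h3 : 0 ≤ ∑ k ∈ range L, ‖z k‖ ^ 2 := sum_nonneg fun _ _ => by positivity
  have h4 := (Complex.re_le_norm (∑ h ∈ range L, ∑ k ∈ range (L - h),
    z (k + h) * (starRingEnd ℂ) (z k))).trans (norm_sum_le _ _)
  linarith

/-- If `h θ` is `ε`-close to an integer for a proportion `1 / R` of the `h < N`, then some small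
positive multiple of `θ` is within `O (ε / N)` of an integer. -/
theorem exists_small_multiple_near_int {θ ε : ℝ} {N R D : ℕ} {A : Finset ℕ}
    (hA : ∀ h ∈ A, h < N) (hAε : ∀ h ∈ A, ∃ p : ℤ, |h * θ - p| ≤ ε) (hR : 1 ≤ R)
    (hcard : N ≤ R * #A) (hε : ε ≤ 1 / 8) (hD : 8 * ε * N ≤ D) (hD1 : 1 ≤ D)
    (hN : 4 * R ^ 2 * D ≤ N) :
    ∃ q : ℕ, 1 ≤ q ∧ q ≤ 2 * R ∧ ∃ p : ℤ, |q * θ - p| ≤ 16 * R ^ 3 * D * ε / N := by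
  have hR2 : R ≤ R ^ 2 := Nat.le_self_pow (by norm_num) R
  have hRD : R ^ 2 ≤ R ^ 2 * D := Nat.le_mul_of_pos_right _ hD1
  have hN4 : 4 * R ≤ N := by linarith [mul_assoc 4 (R ^ 2) D]
  have hA4 : 4 ≤ #A := by
    by_contra hlt
    have : R * #A ≤ R * 3 := Nat.mul_le_mul_left _ (by omega)
    omega
  -- Pigeonhole in blocks of length `2R`: the difference `q` of two elements of `A` in one block has
  -- `q * θ` within `2ε` of an integer. The gain of a factor `N` comes next.
  obtain ⟨a, ha, b, hb, hab, hdiv⟩ : ∃ a ∈ A, ∃ b ∈ A, a < b ∧ a / (2 * R) = b / (2 * R) := by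
    have hmaps : ∀ h ∈ A, h / (2 * R) ∈ range (N / (2 * R) + 1) := fun h hh => by
      rw [mem_range, Nat.lt_succ_iff]
      exact Nat.div_le_div_right (hA h hh).le
    have hlt : #(range (N / (2 * R) + 1)) < #A := by
      rw [card_range]
      have : N / (2 * R) ≤ #A / 2 := by
        calc N / (2 * R) ≤ (R * #A) / (2 * R) := Nat.div_le_div_right hcard
          _ = #A / 2 := by rw [mul_comm 2 R, Nat.mul_div_mul_left _ _ (by omega)]
      omega
    obtain ⟨a, ha, b, hb, hne, heq⟩ := exists_ne_map_eq_of_card_lt_of_maps_to hlt hmaps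
    rcases lt_or_gt_of_ne hne with h | h
    · exact ⟨a, ha, b, hb, h, heq⟩
    · exact ⟨b, hb, a, ha, h, heq.symm⟩
  obtain ⟨q, hq⟩ : ∃ q, q = b - a := ⟨_, rfl⟩
  have hq1 : 1 ≤ q := by omega
  have hq2 : q ≤ 2 * R := by
    have h1 := Nat.div_add_mod a (2 * R)
    have h2 := Nat.div_add_mod b (2 * R)
    have h3 := Nat.mod_lt b (show 0 < 2 * R by omega)
    rw [hdiv] at h1
    omega
  obtain ⟨pa, hpa⟩ := hAε a ha
  obtain ⟨pb, hpb⟩ := hAε b hb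
  have hε0 : 0 ≤ ε := (abs_nonneg _).trans hpa
  have hqr : (q : ℝ) = b - a := by rw [hq, Nat.cast_sub hab.le]
  obtain ⟨η, hη⟩ : ∃ η : ℝ, η = q * θ - (pb - pa : ℤ) := ⟨_, rfl⟩
  have hη2 : |η| ≤ 2 * ε := by
    rw [hη, hqr, show ((b : ℝ) - a) * θ - ((pb - pa : ℤ) : ℝ)
      = (b * θ - pb) - (a * θ - pa) by push_cast; ring]
    exact (abs_sub _ _).trans (by linarith)
  refine ⟨q, hq1, hq2, pb - pa, ?_⟩
  rw [← hη]
  have hNpos : 0 < N := by omega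
  -- A second pigeonhole, by window of length `N / D` and residue modulo `q`. The extreme elements
  -- of a rich fibre differ by `q * t`, with `q * t` below `N / D` but at least `N / (4R²D)`.
  obtain ⟨⟨u, v⟩, -, hF⟩ := exists_le_card_fiber_of_nsmul_le_card_of_maps_to
    (s := A) (t := range D ×ˢ range q) (f := fun h => (h * D / N, h % q))
    (b := (N : ℝ) / (2 * R ^ 2 * D))
    (fun h hh => by
      rw [mem_product, mem_range, mem_range]
      refine ⟨?_, Nat.mod_lt _ (by omega)⟩
      rw [Nat.div_lt_iff_lt_mul hNpos, mul_comm D N]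
      exact Nat.mul_lt_mul_of_pos_right (hA h hh) hD1)
    ⟨(0, 0), by simp; omega⟩
    (by
      rw [card_product, card_range, card_range, nsmul_eq_mul]
      have hR' : (0 : ℝ) < R := by exact_mod_cast hR
      have hD' : (0 : ℝ) < D := by exact_mod_cast hD1
      have hc : (N : ℝ) ≤ R * #A := by exact_mod_cast hcard
      have hq' : (q : ℝ) ≤ 2 * R := by exact_mod_cast hq2
      push_cast
      calc (D : ℝ) * q * (N / (2 * R ^ 2 * D)) ≤ D * (2 * R) * (R * #A / (2 * R ^ 2 * D)) := by
            gcongr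
        _ = (#A : ℝ) := by field_simp)
  set F := A.filter (fun h => (h * D / N, h % q) = (u, v)) with hFdef
  have hR' : (0 : ℝ) < R := by exact_mod_cast hR
  have hD' : (0 : ℝ) < D := by exact_mod_cast hD1
  have hN' : (0 : ℝ) < N := by exact_mod_cast hNpos
  have hμ : 2 ≤ (N : ℝ) / (2 * R ^ 2 * D) := by
    rw [le_div_iff₀ (by positivity)]
    have : (4 : ℝ) * R ^ 2 * D ≤ N := by exact_mod_cast hN
    linarith
  have hF2 : (2 : ℝ) ≤ #F := hμ.trans hF
  have hFne : F.Nonempty := by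
    rw [← card_pos]; exact_mod_cast (by linarith : (0 : ℝ) < #F)
  obtain ⟨h, hh⟩ : ∃ h, h = F.min' hFne := ⟨_, rfl⟩
  obtain ⟨h', hh'⟩ : ∃ h', h' = F.max' hFne := ⟨_, rfl⟩
  have hmem : h ∈ F := hh ▸ F.min'_mem hFne
  have hmem' : h' ∈ F := hh' ▸ F.max'_mem hFne
  have hle : h ≤ h' := hh ▸ F.min'_le _ hmem'
  have hcardF : #F ≤ h' - h + 1 := by
    have : F ⊆ Icc h h' := fun y hy =>
      mem_Icc.2 ⟨hh ▸ F.min'_le _ hy, hh' ▸ F.le_max' _ hy⟩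
    have := card_le_card this
    rw [Nat.card_Icc] at this
    omega
  rw [hFdef, mem_filter, Prod.mk.injEq] at hmem hmem'
  obtain ⟨hhA, hhu, hhv⟩ := hmem
  obtain ⟨hhA', hhu', hhv'⟩ := hmem'
  obtain ⟨t, ht⟩ : q ∣ h' - h := (Nat.modEq_iff_dvd' hle).1 (hhv.trans hhv'.symm)
  have htr : (h' : ℝ) - h = q * t := by rw [← Nat.cast_sub hle, ht]; push_cast; ring
  have hwin : (h' - h) * D < N := by
    have h1 := Nat.div_add_mod (h * D) N
    have h2 := Nat.div_add_mod (h' * D) N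
    have h3 := Nat.mod_lt (h' * D) hNpos
    rw [hhu] at h1
    rw [hhu'] at h2
    rw [Nat.sub_mul]
    omega
  have hwin' : (q : ℝ) * t * D < N := by
    have : ((h' - h : ℕ) : ℝ) * D < N := by exact_mod_cast hwin
    rwa [ht, Nat.cast_mul] at this
  have hq1' : (1 : ℝ) ≤ q := by exact_mod_cast hq1
  have hq2' : (q : ℝ) ≤ 2 * R := by exact_mod_cast hq2
  have ht0 : (0 : ℝ) ≤ t := Nat.cast_nonneg t
  have hfar : (N : ℝ) / (4 * R ^ 2 * D) ≤ q * t := by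
    have h1 : (#F : ℝ) ≤ q * t + 1 := by
      have : (#F : ℝ) ≤ ((h' - h : ℕ) : ℝ) + 1 := by exact_mod_cast hcardF
      rwa [ht, Nat.cast_mul] at this
    have h2 : (N : ℝ) / (4 * R ^ 2 * D) = N / (2 * R ^ 2 * D) / 2 := by
      field_simp; norm_num
    linarith
  have htpos : (0 : ℝ) < t := by
    have : (0 : ℝ) < N / (4 * R ^ 2 * D) := by positivity
    by_contra hcon
    nlinarith
  obtain ⟨p, hp⟩ := hAε h hhA
  obtain ⟨p', hp'⟩ := hAε h' hhA'
  -- `t * η` is within `2ε` of an integer and, as `8εN ≤ D`, at most `1/4` in absolute value. That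
  -- integer is therefore `0`, and dividing by the large `t` improves the bound on `η`.
  have htη : |t * η| ≤ 2 * ε := by
    have h1 : |t * η - (p' - p - t * (pb - pa) : ℤ)| ≤ 2 * ε := by
      have : (t * η - (p' - p - t * (pb - pa) : ℤ) : ℝ) = (h' * θ - p') - (h * θ - p) := by
        have : (h' : ℝ) = q * t + h := by linarith
        rw [this, hη]; push_cast; ring
      rw [this]
      exact (abs_sub _ _).trans (by linarith)
    have h2 : |t * η| ≤ 1 / 4 := by
      rw [abs_mul, abs_of_nonneg ht0]
      have h3 : t * D ≤ (N : ℝ) := by nlinarith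
      have h4 : t * |η| * D ≤ 1 / 4 * D := by
        calc t * |η| * D = t * D * |η| := by ring
          _ ≤ N * (2 * ε) := by gcongr
          _ ≤ _ := by linarith
      exact le_of_mul_le_mul_right h4 hD'
    have h3 : (p' - p - t * (pb - pa) : ℤ) = 0 := by
      rw [← Int.abs_lt_one_iff]
      have : |((p' - p - t * (pb - pa) : ℤ) : ℝ)| < 1 := by
        rw [abs_le] at h1 h2
        rw [abs_lt]; constructor <;> linarith
      exact_mod_cast this
    rw [h3] at h1
    simpa using h1
  rw [abs_mul, abs_of_nonneg ht0] at htη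
  rw [le_div_iff₀ hN']
  rw [div_le_iff₀ (by positivity)] at hfar
  calc |η| * N ≤ |η| * (q * t * (4 * R ^ 2 * D)) := by gcongr
    _ = (t * |η|) * q * (4 * R ^ 2 * D) := by ring
    _ ≤ (2 * ε) * (2 * R) * (4 * R ^ 2 * D) := by gcongr
    _ = _ := by ring

/-- The phase after differencing: the degree drops by one, and the new top coefficient is linear in
the shift `h`. -/
theorem natDegree_taylor_sub_le {n : ℕ} {P : ℝ[X]} (hP : P.natDegree ≤ n + 1) (h : ℝ) :
    (taylor h P - P).natDegree ≤ n ∧ (taylor h P - P).coeff n = (n + 1) * h * P.coeff (n + 1) := by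
  constructor
  · rw [natDegree_le_iff_coeff_eq_zero]
    intro m hm
    rw [coeff_sub]
    rcases Nat.lt_or_ge (n + 1) m with h1 | h1
    · rw [coeff_eq_zero_of_natDegree_lt (by rw [natDegree_taylor]; omega),
        coeff_eq_zero_of_natDegree_lt (by omega), sub_zero]
    · obtain rfl : m = n + 1 := by omega
      have h2 : (hasseDeriv (n + 1) P).natDegree ≤ 0 :=
        (natDegree_hasseDeriv_le P (n + 1)).trans (by omega)
      rw [taylor_coeff, eq_C_of_natDegree_le_zero h2, eval_C, hasseDeriv_coeff]
      simp
  · have h2 : (hasseDeriv n P).natDegree ≤ 1 :=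
      (natDegree_hasseDeriv_le P n).trans (by omega)
    rw [coeff_sub, taylor_coeff, eq_X_add_C_of_natDegree_le_one h2]
    simp only [eval_add, eval_mul, eval_C, eval_X, hasseDeriv_coeff]
    rw [add_comm 1 n, Nat.choose_symm_add]
    simp
    ring

/-- A quantitative Weyl inequality: a polynomial phase with a large exponential sum has leading
coefficient close to a rational number with small denominator. -/
theorem exists_rational_approx_of_large_weyl_sum (n : ℕ) : ∃ C : ℕ, ∀ P : ℝ[X],
    P.natDegree ≤ n + 1 → ∀ Q L N : ℕ, 2 ≤ Q → L ≤ N → 1 ≤ N →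
    (N : ℝ) ≤ Q * ‖∑ k ∈ range L, expTwoPi (P.eval (k : ℝ))‖ →
    ∃ q : ℕ, 1 ≤ q ∧ q ≤ Q ^ C ∧
      ∃ p : ℤ, |q * P.coeff (n + 1) - p| ≤ (Q : ℝ) ^ C / N ^ (n + 1) := by
  induction n with
  | zero =>
    refine ⟨1, fun P hP Q L N hQ hL hN hS => ?_⟩
    refine ⟨1, le_rfl, by simp; omega, round (P.coeff 1), ?_⟩
    have e : ∀ k : ℕ, P.eval (k : ℝ) = P.coeff 0 + P.coeff 1 * k := by
      intro k
      conv_lhs => rw [eq_X_add_C_of_natDegree_le_one hP]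
      simp; ring
    simp only [e] at hS
    have h := norm_sum_expTwoPi_linear_le (P.coeff 0) (P.coeff 1) L
    have hN' : (0 : ℝ) < N := by exact_mod_cast hN
    simp only [Nat.cast_one, one_mul, zero_add, pow_one]
    rw [le_div_iff₀ hN']
    have hQ' : (0 : ℝ) ≤ Q := Nat.cast_nonneg Q
    set S := ‖∑ k ∈ range L, expTwoPi (P.coeff 0 + P.coeff 1 * k)‖
    set η := |P.coeff 1 - round (P.coeff 1)|
    have hη : 0 ≤ η := abs_nonneg _
    calc η * N ≤ η * (Q * S) := by gcongr
      _ = Q * (S * (2 * η)) / 2 := by ring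
      _ ≤ Q * 1 / 2 := by gcongr
      _ ≤ Q := by linarith
  | succ n ih =>
    obtain ⟨C, hC⟩ := ih
    -- The first summand of the exponent settles `N < Q^(12C+13)` trivially, `20C+19` is the loss in
    -- the approximation, and `n+1` absorbs the factor `n + 2 ≤ Q^(n+1)`.
    refine ⟨(12 * C + 13) * (n + 2) + 20 * C + 19 + (n + 1), fun P hP Q L N hQ hL hN hS => ?_⟩
    set C' := (12 * C + 13) * (n + 2) + 20 * C + 19 + (n + 1) with hC'
    have hQ1 : 1 ≤ Q := by omega
    have hQ2 : (2 : ℝ) ≤ Q := by exact_mod_cast hQ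
    have hQr : (1 : ℝ) ≤ Q := by linarith
    have hN' : (0 : ℝ) < N := by exact_mod_cast hN
    have hN1 : (1 : ℝ) ≤ N := by exact_mod_cast hN
    have hQ4 : (4 : ℝ) * Q ^ 2 ≤ Q ^ 4 := by
      have : (4 : ℝ) ≤ Q ^ 2 := by nlinarith
      nlinarith
    set θ := P.coeff (n + 1 + 1) with hθ
    by_cases hsmall : N < Q ^ (12 * C + 13)
    · refine ⟨1, le_rfl, Nat.one_le_pow _ _ hQ1, round θ, ?_⟩
      have h1 : |((1 : ℕ) : ℝ) * θ - round θ| ≤ 1 := by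
        rw [Nat.cast_one, one_mul]; linarith [abs_sub_round θ]
      refine h1.trans ?_
      rw [le_div_iff₀ (by positivity), one_mul]
      have h2 : (N : ℝ) ≤ Q ^ (12 * C + 13) := by exact_mod_cast hsmall.le
      calc (N : ℝ) ^ (n + 1 + 1) ≤ (Q ^ (12 * C + 13)) ^ (n + 1 + 1) := by gcongr
        _ = Q ^ ((12 * C + 13) * (n + 2)) := by rw [← pow_mul]
        _ ≤ Q ^ C' := pow_le_pow_right₀ hQr (by omega)
    push Not at hsmall
    set T : ℕ → ℝ := fun h => ‖∑ k ∈ range (L - h),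
      expTwoPi ((taylor (h : ℝ) P - P).eval (k : ℝ))‖ with hT
    have hvdc : ‖∑ k ∈ range L, expTwoPi (P.eval (k : ℝ))‖ ^ 2 ≤ 2 * ∑ h ∈ range L, T h := by
      refine (norm_sq_sum_le_two_mul_sum_norm_correlation _ L).trans (le_of_eq ?_)
      congr 1
      refine sum_congr rfl fun h _ => ?_
      rw [hT]
      dsimp only
      congr 1
      refine sum_congr rfl fun k _ => ?_
      rw [conj_expTwoPi, ← expTwoPi_add, eval_sub, taylor_eval]
      push_cast
      ring_nf
    have hTN : ∀ h, T h ≤ N := by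
      intro h
      refine (norm_sum_le _ _).trans ?_
      simp only [norm_expTwoPi, sum_const, card_range, nsmul_eq_mul, mul_one]
      exact_mod_cast (by omega : L - h ≤ N)
    -- Shifts with a large correlation; by averaging they make up a proportion at least `Q⁻⁴` of
    -- `N`. The threshold works because `4Q² ≤ Q⁴`.
    set H := (range L).filter (fun h => (N : ℝ) ≤ (Q ^ 4 : ℕ) * T h) with hH
    have hHcard : N ≤ Q ^ 4 * #H := by
      have h1 : ∑ h ∈ range L, T h ≤ #H * N + N * (N / (4 * Q ^ 2)) := by
        calc ∑ h ∈ range L, T h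
            ≤ ∑ h ∈ range L, ((if (N : ℝ) ≤ (Q ^ 4 : ℕ) * T h then (N : ℝ) else 0)
                + N / (4 * Q ^ 2)) := by
              refine sum_le_sum fun h _ => ?_
              split_ifs with hif
              · have : (0 : ℝ) ≤ N / (4 * Q ^ 2) := by positivity
                linarith [hTN h]
              · push Not at hif
                rw [zero_add, le_div_iff₀ (by positivity)]
                push_cast at hif
                have : 0 ≤ T h := norm_nonneg _
                nlinarith [mul_le_mul_of_nonneg_right hQ4 this]
          _ = #H * N + L * (N / (4 * Q ^ 2)) := by
              rw [sum_add_distrib, ← sum_filter, sum_const, sum_const, card_range, nsmul_eq_mul,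
                nsmul_eq_mul]
          _ ≤ _ := by
              have : (L : ℝ) ≤ N := by exact_mod_cast hL
              gcongr
      set S := ‖∑ k ∈ range L, expTwoPi (P.eval (k : ℝ))‖
      have hS0 : 0 ≤ S := norm_nonneg _
      have h2 : (N : ℝ) ^ 2 ≤ Q ^ 2 * S ^ 2 := by
        rw [← mul_pow]; gcongr
      have h3 : (N : ℝ) ^ 2 ≤ Q ^ 2 * (2 * (#H * N + N * (N / (4 * Q ^ 2)))) := by
        refine h2.trans ?_
        gcongr
        linarith
      have h4 : (Q : ℝ) ^ 2 * (2 * (#H * N + N * (N / (4 * Q ^ 2))))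
          = 2 * Q ^ 2 * #H * N + N ^ 2 / 2 := by field_simp; ring
      rw [h4] at h3
      have h5 : (N : ℝ) * N ≤ (4 * Q ^ 2 * #H) * N := by nlinarith
      have h6 := le_of_mul_le_mul_right h5 hN'
      have h7 : (N : ℝ) ≤ Q ^ 4 * #H := by
        refine h6.trans ?_
        gcongr
      exact_mod_cast h7
    have hstep : ∀ h ∈ H, ∃ q : ℕ, (1 ≤ q ∧ q ≤ (Q ^ 4) ^ C) ∧
        ∃ p : ℤ, |(h : ℝ) * (q * (n + 2) * θ) - p| ≤ (Q : ℝ) ^ (4 * C) / N ^ (n + 1) := by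
      intro h hh
      rw [hH, mem_filter] at hh
      obtain ⟨hdeg, hcoeff⟩ := natDegree_taylor_sub_le hP (h : ℝ)
      obtain ⟨q, hq1, hq2, p, hp⟩ := hC (taylor (h : ℝ) P - P) hdeg (Q ^ 4) (L - h) N
        (hQ.trans (Nat.le_self_pow (by norm_num) Q)) (by omega) hN hh.2
      refine ⟨q, ⟨hq1, hq2⟩, p, ?_⟩
      rw [hcoeff] at hp
      push_cast at hp
      rw [pow_mul]
      convert hp using 3
      ring
    choose! qf hqf pf hpf using hstep
    -- The denominators from the induction hypothesis depend on `h`; pigeonhole fixes one `q` for a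
    -- positive proportion of `H`.
    obtain ⟨q, hqmem, hA⟩ := exists_le_card_fiber_of_nsmul_le_card_of_maps_to
      (s := H) (t := Icc 1 ((Q ^ 4) ^ C)) (f := qf) (b := (#H : ℝ) / ((Q ^ 4) ^ C : ℕ))
      (fun h hh => mem_Icc.2 (hqf h hh)) ⟨1, by simp; exact Nat.one_le_pow _ _ (by positivity)⟩
      (by
        rw [Nat.card_Icc, nsmul_eq_mul, Nat.add_sub_cancel]
        have : (0 : ℝ) < ((Q ^ 4) ^ C : ℕ) := by positivity
        rw [mul_div_cancel₀ _ this.ne'])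
    rw [mem_Icc] at hqmem
    set A := H.filter (fun h => qf h = q) with hAdef
    have hAcard : N ≤ Q ^ (4 * C + 4) * #A := by
      have h0 : (0 : ℝ) < ((Q ^ 4) ^ C : ℕ) := by positivity
      rw [div_le_iff₀ h0] at hA
      have h1 : #H ≤ #A * (Q ^ 4) ^ C := by exact_mod_cast hA
      calc N ≤ Q ^ 4 * #H := hHcard
        _ ≤ Q ^ 4 * (#A * (Q ^ 4) ^ C) := Nat.mul_le_mul_left _ h1
        _ = _ := by rw [← pow_mul, pow_add]; ring
    have h4le : 4 ≤ Q ^ 2 := by nlinarith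
    have h8le : (8 : ℝ) ≤ Q ^ 3 := by
      calc (8 : ℝ) = 2 ^ 3 := by norm_num
        _ ≤ Q ^ 3 := by gcongr
    have hNbig : 4 * (Q ^ (4 * C + 4)) ^ 2 * Q ^ (4 * C + 3) ≤ N := by
      refine le_trans ?_ hsmall
      calc 4 * (Q ^ (4 * C + 4)) ^ 2 * Q ^ (4 * C + 3)
          ≤ Q ^ 2 * (Q ^ (4 * C + 4)) ^ 2 * Q ^ (4 * C + 3) := by gcongr
        _ = Q ^ (12 * C + 13) := by rw [← pow_mul, ← pow_add, ← pow_add]; congr 1; ring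
    have hε : (Q : ℝ) ^ (4 * C) / N ^ (n + 1) * N ≤ Q ^ (4 * C) := by
      rw [div_mul_eq_mul_div, div_le_iff₀ (by positivity), pow_succ]
      have : (1 : ℝ) ≤ N ^ n := one_le_pow₀ hN1
      have h2 : (0 : ℝ) ≤ Q ^ (4 * C) * N := by positivity
      nlinarith
    obtain ⟨q', hq1', hq2', p, hp⟩ := exists_small_multiple_near_int
      (θ := q * (n + 2) * θ) (ε := (Q : ℝ) ^ (4 * C) / N ^ (n + 1)) (N := N)
      (R := Q ^ (4 * C + 4)) (D := Q ^ (4 * C + 3)) (A := A)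
      (fun h hh => by
        rw [hAdef, mem_filter, hH, mem_filter, mem_range] at hh; omega)
      (fun h hh => by
        rw [hAdef, mem_filter] at hh
        have := hpf h hh.1
        rw [hh.2] at this
        exact ⟨_, this⟩)
      (Nat.one_le_pow _ _ hQ1) hAcard
      (by
        rw [div_le_iff₀ (by positivity)]
        have h1 : (Q : ℝ) ^ (12 * C + 13) ≤ N := by exact_mod_cast hsmall
        have h2 : (N : ℝ) ≤ N ^ (n + 1) := le_self_pow₀ hN1 (by omega)
        have h3 : (Q : ℝ) ^ (4 * C) * 8 ≤ Q ^ (12 * C + 13) := by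
          calc (Q : ℝ) ^ (4 * C) * 8 ≤ Q ^ (4 * C) * Q ^ 3 := by gcongr
            _ = Q ^ (4 * C + 3) := by rw [pow_add]
            _ ≤ _ := pow_le_pow_right₀ hQr (by omega)
        linarith)
      (by
        push_cast
        calc 8 * ((Q : ℝ) ^ (4 * C) / N ^ (n + 1)) * N
            = 8 * ((Q : ℝ) ^ (4 * C) / N ^ (n + 1) * N) := by ring
          _ ≤ Q ^ 3 * Q ^ (4 * C) := by gcongr
          _ = Q ^ (4 * C + 3) := by rw [← pow_add]; congr 1; ring)
      (Nat.one_le_pow _ _ hQ1) hNbig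
    have hn2 : n + 2 ≤ Q ^ (n + 1) := by
      calc n + 2 ≤ 2 ^ (n + 1) := Nat.lt_two_pow_self
        _ ≤ Q ^ (n + 1) := Nat.pow_le_pow_left hQ _
    refine ⟨q' * (q * (n + 2)), Nat.mul_pos hq1' (Nat.mul_pos hqmem.1 (by omega)), ?_, p, ?_⟩
    · calc q' * (q * (n + 2)) ≤ (2 * Q ^ (4 * C + 4)) * ((Q ^ 4) ^ C * Q ^ (n + 1)) :=
            Nat.mul_le_mul hq2' (Nat.mul_le_mul hqmem.2 hn2)
        _ ≤ (Q * Q ^ (4 * C + 4)) * ((Q ^ 4) ^ C * Q ^ (n + 1)) := by gcongr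
        _ = Q ^ (8 * C + 5 + (n + 1)) := by
            rw [← pow_mul, ← pow_add, ← pow_succ', ← pow_add]; congr 1; ring
        _ ≤ Q ^ C' := Nat.pow_le_pow_right hQ1 (by rw [hC']; nlinarith)
    · have e : ((q' * (q * (n + 2)) : ℕ) : ℝ) * θ = q' * (q * (n + 2) * θ) := by
        push_cast; ring
      rw [e]
      refine hp.trans ?_
      push_cast
      have h16 : (16 : ℝ) ≤ Q ^ 4 := by
        calc (16 : ℝ) = 2 ^ 4 := by norm_num
          _ ≤ Q ^ 4 := by gcongr
      calc 16 * ((Q : ℝ) ^ (4 * C + 4)) ^ 3 * Q ^ (4 * C + 3) * (Q ^ (4 * C) / N ^ (n + 1)) / N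
          ≤ Q ^ 4 * ((Q : ℝ) ^ (4 * C + 4)) ^ 3 * Q ^ (4 * C + 3)
              * (Q ^ (4 * C) / N ^ (n + 1)) / N := by gcongr
        _ = (Q : ℝ) ^ (20 * C + 19) / N ^ (n + 1 + 1) := by
            rw [pow_succ (N : ℝ) (n + 1)]
            have : (Q : ℝ) ^ (20 * C + 19)
                = Q ^ 4 * ((Q : ℝ) ^ (4 * C + 4)) ^ 3 * Q ^ (4 * C + 3) * Q ^ (4 * C) := by
              rw [← pow_mul, ← pow_add, ← pow_add, ← pow_add]; congr 1; ring
            rw [this]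
            field_simp
        _ ≤ (Q : ℝ) ^ C' / N ^ (n + 1 + 1) := by
            gcongr
            rw [hC']; omega

/-! ### Sine sums at and near rational points for odd exponents. -/

theorem abs_sum_range_le_of_periodic {s : ℕ → ℝ} {q : ℕ} (hq : 1 ≤ q) (hs : ∀ k, |s k| ≤ 1)
    (hper : ∀ k, s (k + q) = s k) (hzero : ∑ k ∈ range q, s k = 0) (a L : ℕ) :
    |∑ i ∈ range L, s (a + i)| ≤ q := by
  have hz : ∀ a, ∑ i ∈ range q, s (a + i) = 0 := by
    intro a
    induction a with
    | zero => simpa using hzero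
    | succ a ih =>
      have h1 := sum_range_succ (fun i => s (a + i)) q
      rw [sum_range_succ', ih, hper a] at h1
      simp only [add_zero, zero_add] at h1
      rw [← add_left_inj (s a), zero_add, ← h1]
      congr 1
      exact sum_congr rfl fun i _ => by rw [add_assoc, add_comm 1 i]
  induction L using Nat.strong_induction_on generalizing a with
  | _ L ih =>
    rcases Nat.lt_or_ge L q with h | h
    · calc |∑ i ∈ range L, s (a + i)| ≤ ∑ i ∈ range L, |s (a + i)| := abs_sum_le_sum_abs _ _
        _ ≤ ∑ i ∈ range L, (1 : ℝ) := sum_le_sum fun i _ => hs _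
        _ = L := by simp
        _ ≤ q := by exact_mod_cast h.le
    · obtain ⟨L', rfl⟩ := Nat.exists_eq_add_of_le h
      rw [sum_range_add, hz, zero_add]
      have := ih L' (by omega) (a + q)
      simpa only [add_assoc] using this

theorem sin_two_pi_mul_div_congr (p : ℤ) {q : ℕ} (hq : 1 ≤ q) {u v : ℤ} (h : (q : ℤ) ∣ u - v) :
    Real.sin (2 * Real.pi * (p / q * u)) = Real.sin (2 * Real.pi * (p / q * v)) := by
  obtain ⟨z, hz⟩ := h
  have hu : (u : ℝ) = v + q * z := by
    have : u = v + q * z := by linarith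
    exact_mod_cast this
  have hq' : (q : ℝ) ≠ 0 := by positivity
  have : 2 * Real.pi * ((p : ℝ) / q * u)
      = 2 * Real.pi * (p / q * v) + ((p * z : ℤ) : ℝ) * (2 * Real.pi) := by
    rw [hu]; push_cast; field_simp
  rw [this, Real.sin_add_int_mul_two_pi]

/-- For odd `n` the reflection `k ↦ q - k` changes the sign of the summand, so a complete period
sums to zero and only an incomplete one remains. -/
theorem abs_sum_sin_rational_le {n : ℕ} (hn : Odd n) (p : ℤ) {q : ℕ} (hq : 1 ≤ q) (a b : ℕ) :
    |∑ k ∈ Ico a b, Real.sin (2 * Real.pi * (p / q * (k : ℝ) ^ n))| ≤ q := by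
  rw [sum_Ico_eq_sum_range]
  have hcong : ∀ u v : ℤ, (q : ℤ) ∣ u - v → Real.sin (2 * Real.pi * (p / q * (u : ℝ)))
      = Real.sin (2 * Real.pi * (p / q * (v : ℝ))) := fun u v h => sin_two_pi_mul_div_congr p hq h
  refine abs_sum_range_le_of_periodic
    (s := fun k => Real.sin (2 * Real.pi * (p / q * (k : ℝ) ^ n))) hq
    (fun k => Real.abs_sin_le_one _) (fun k => ?_) ?_ a (b - a)
  · have := hcong ((k + q : ℤ) ^ n) ((k : ℤ) ^ n) (by
      have := sub_dvd_pow_sub_pow (k + q : ℤ) k n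
      simpa using this)
    push_cast at this ⊢
    exact this
  · set s : ℕ → ℝ := fun k => Real.sin (2 * Real.pi * (p / q * (k : ℝ) ^ n)) with hs
    have hn0 : n ≠ 0 := by rintro rfl; simp at hn
    have hneg : ∀ i ∈ range q, s (q - 1 - i) = -s (i + 1) := by
      intro i hi
      rw [mem_range] at hi
      have e : ((q - 1 - i : ℕ) : ℤ) = q - (i + 1) := by omega
      have := hcong (((q - 1 - i : ℕ) : ℤ) ^ n) (-((i + 1 : ℤ) ^ n)) (by
        rw [e, ← hn.neg_pow]
        have := sub_dvd_pow_sub_pow ((q : ℤ) - (i + 1)) (-(i + 1)) n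
        rwa [sub_neg_eq_add, sub_add_cancel] at this)
      push_cast at this
      rw [hs]
      dsimp only
      rw [← Real.sin_neg]
      have e2 : (((q - 1 - i : ℕ) : ℤ) : ℝ) = ((q - 1 - i : ℕ) : ℝ) := by norm_cast
      rw [← e2]
      push_cast
      rw [this]
      congr 1; ring
    have h0 : s 0 = 0 := by simp [hs, hn0]
    have hq0 : s q = 0 := by
      have := hcong ((q : ℤ) ^ n) 0 (by rw [sub_zero]; exact dvd_pow_self _ hn0)
      simpa [hs] using this
    have h1 : ∑ k ∈ range q, s k = -∑ k ∈ range q, s (k + 1) := by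
      rw [← sum_range_reflect, sum_congr rfl hneg, sum_neg_distrib]
    have h2 := sum_range_succ s q
    rw [sum_range_succ', h0, hq0] at h2
    linarith

theorem abs_sin_sub_sin_le (s t : ℝ) : |Real.sin s - Real.sin t| ≤ |s - t| := by
  rw [Real.sin_sub_sin, abs_mul, abs_mul, abs_two]
  have h1 : |Real.sin ((s - t) / 2)| ≤ |(s - t) / 2| := Real.abs_sin_le_abs
  have h2 := Real.abs_cos_le_one ((s + t) / 2)
  rw [abs_div, abs_two] at h1
  nlinarith [abs_nonneg (Real.sin ((s - t) / 2)), abs_nonneg (Real.cos ((s + t) / 2))]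

/-- Replacing `x / 2π` by `r` costs at most `2π k^n |x / 2π - r|` per term, with `k ≤ 2^(j+1)`. -/
theorem abs_sum_sin_le_near_rational {n : ℕ} (hn : Odd n) (x : ℝ) (r : ℚ) {j a b : ℕ}
    (ha : 2 ^ j ≤ a) (hb : b ≤ 2 ^ (j + 1)) :
    |∑ k ∈ Ico a b, Real.sin ((k : ℝ) ^ n * x)|
      ≤ r.den + 2 ^ j * (2 * Real.pi * 2 ^ n * (|x / (2 * Real.pi) - r| * 2 ^ (j * n))) := by
  have hpi := Real.pi_pos
  have h1 := abs_sum_sin_rational_le hn r.num (q := r.den) r.den_pos a b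
  have hr : (r.num : ℝ) / r.den = r := by exact_mod_cast r.num_div_den
  rw [hr] at h1
  set β := |x / (2 * Real.pi) - r| with hβ
  have h2 : ∀ k ∈ Ico a b, |Real.sin ((k : ℝ) ^ n * x) - Real.sin (2 * Real.pi * (r * (k : ℝ) ^ n))|
      ≤ 2 * Real.pi * 2 ^ n * (β * 2 ^ (j * n)) := by
    intro k hk
    rw [mem_Ico] at hk
    refine (abs_sin_sub_sin_le _ _).trans ?_
    have e : (k : ℝ) ^ n * x - 2 * Real.pi * (r * (k : ℝ) ^ n)
        = 2 * Real.pi * (k : ℝ) ^ n * (x / (2 * Real.pi) - r) := by field_simp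
    rw [e, abs_mul, ← hβ, abs_of_nonneg (by positivity)]
    have hk2 : (k : ℝ) ≤ 2 * 2 ^ j := by
      have : k ≤ 2 ^ (j + 1) := by omega
      rw [pow_succ'] at this
      exact_mod_cast this
    calc 2 * Real.pi * (k : ℝ) ^ n * β ≤ 2 * Real.pi * (2 * 2 ^ j) ^ n * β := by gcongr
      _ = _ := by rw [mul_pow, ← pow_mul]; ring
  have h3 : |∑ k ∈ Ico a b, (Real.sin ((k : ℝ) ^ n * x)
      - Real.sin (2 * Real.pi * (r * (k : ℝ) ^ n)))|
      ≤ 2 ^ j * (2 * Real.pi * 2 ^ n * (β * 2 ^ (j * n))) := by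
    refine (abs_sum_le_sum_abs _ _).trans ((sum_le_sum h2).trans ?_)
    rw [sum_const, Nat.card_Ico, nsmul_eq_mul]
    gcongr
    rw [pow_succ] at hb
    exact_mod_cast (by omega : b - a ≤ 2 ^ j)
  rw [sum_sub_distrib] at h3
  have h4 := abs_sub_abs_le_abs_sub (∑ k ∈ Ico a b, Real.sin ((k : ℝ) ^ n * x))
    (∑ k ∈ Ico a b, Real.sin (2 * Real.pi * (r * (k : ℝ) ^ n)))
  linarith

theorem abs_sum_sin_le_norm_sum_expTwoPi (s : Finset ℕ) (f : ℕ → ℝ) :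
    |∑ k ∈ s, Real.sin (2 * Real.pi * f k)| ≤ ‖∑ k ∈ s, expTwoPi (f k)‖ := by
  have : ∑ k ∈ s, Real.sin (2 * Real.pi * f k) = (∑ k ∈ s, expTwoPi (f k)).im := by
    rw [Complex.im_sum]
    exact sum_congr rfl fun k _ => (expTwoPi_im _).symm
  rw [this]
  exact Complex.abs_im_le_norm _

theorem abs_sum_sin_le_two_pow (f : ℕ → ℝ) {j a b : ℕ} (ha : 2 ^ j ≤ a) (hb : b ≤ 2 ^ (j + 1)) :
    |∑ k ∈ Ico a b, Real.sin (f k)| ≤ 2 ^ j := by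
  calc |∑ k ∈ Ico a b, Real.sin (f k)| ≤ ∑ k ∈ Ico a b, |Real.sin (f k)| :=
        abs_sum_le_sum_abs _ _
    _ ≤ ∑ k ∈ Ico a b, (1 : ℝ) := sum_le_sum fun i _ => Real.abs_sin_le_one _
    _ = ((b - a : ℕ) : ℝ) := by simp
    _ ≤ 2 ^ j := by
      rw [pow_succ] at hb
      exact_mod_cast (by omega : b - a ≤ 2 ^ j)

/-- The inverse Weyl inequality at scale `N = 2^j` with `Q` of size `1 / σ`; the constant `3`
absorbs rounding. -/
theorem exists_rational_approx_of_sine_sum {n : ℕ} (hn : 1 ≤ n) : ∃ C : ℕ, 1 ≤ C ∧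
    ∀ (x σ : ℝ) (j a b : ℕ), 2 ^ j ≤ a → b ≤ 2 ^ (j + 1) → 0 < σ →
      σ * 2 ^ j = |∑ k ∈ Ico a b, Real.sin ((k : ℝ) ^ n * x)| →
      ∃ r : ℚ, (r.den : ℝ) ≤ (3 / σ) ^ C ∧
        |x / (2 * Real.pi) - r| * 2 ^ (j * n) ≤ (3 / σ) ^ C := by
  obtain ⟨m, rfl⟩ : ∃ m, n = m + 1 := ⟨n - 1, by omega⟩
  obtain ⟨C, hC⟩ := exists_rational_approx_of_large_weyl_sum m
  refine ⟨C + 1, by omega, fun x σ j a b ha hb hσ hS => ?_⟩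
  have hpi := Real.pi_pos
  have hσ1 : σ ≤ 1 := by
    have := abs_sum_sin_le_two_pow (fun k => (k : ℝ) ^ (m + 1) * x) ha hb
    rw [← hS] at this
    have h2 : (0 : ℝ) < 2 ^ j := by positivity
    nlinarith
  set θ := x / (2 * Real.pi) with hθ
  -- The shift by `a` moves the range of summation to start at `0` without changing the leading
  -- coefficient.
  set P : ℝ[X] := taylor (a : ℝ) (monomial (m + 1) θ) with hP
  have hdeg : P.natDegree ≤ m + 1 := by
    rw [hP, natDegree_taylor]; exact natDegree_monomial_le _
  have hcoeff : P.coeff (m + 1) = θ := by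
    rw [hP, taylor_coeff, hasseDeriv_monomial]; simp
  obtain ⟨Q, hQdef⟩ : ∃ Q : ℕ, Q = ⌈1 / σ⌉₊ + 1 := ⟨_, rfl⟩
  have hσinv : 1 ≤ 1 / σ := by rw [le_div_iff₀ hσ]; linarith
  have hQ2 : 2 ≤ Q := by
    have : 0 < ⌈1 / σ⌉₊ := Nat.ceil_pos.2 (by linarith)
    omega
  have hQle : (Q : ℝ) ≤ 3 / σ := by
    have := Nat.ceil_lt_add_one (by linarith : 0 ≤ 1 / σ)
    rw [hQdef, show 3 / σ = 3 * (1 / σ) by ring]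
    push_cast; linarith
  have hQge : 1 / σ ≤ Q := by
    rw [hQdef]; push_cast; linarith [Nat.le_ceil (1 / σ)]
  have hsum : |∑ k ∈ Ico a b, Real.sin ((k : ℝ) ^ (m + 1) * x)|
      ≤ ‖∑ k ∈ range (b - a), expTwoPi (P.eval (k : ℝ))‖ := by
    have := abs_sum_sin_le_norm_sum_expTwoPi (range (b - a)) (fun k => P.eval (k : ℝ))
    refine le_trans (le_of_eq ?_) this
    rw [sum_Ico_eq_sum_range]
    congr 1
    refine sum_congr rfl fun k _ => ?_
    rw [hP, taylor_eval, eval_monomial, hθ]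
    congr 1
    push_cast
    field_simp
    ring
  obtain ⟨q, hq1, hq2, p, hp⟩ := hC P hdeg Q (b - a) (2 ^ j) hQ2
    (by rw [pow_succ] at hb; omega) Nat.one_le_two_pow (by
      refine le_trans ?_ (mul_le_mul hQge hsum (abs_nonneg _) (Nat.cast_nonneg Q))
      rw [← hS]
      push_cast
      field_simp
      exact le_rfl)
  have hK1 : (1 : ℝ) ≤ 3 / σ := by rw [le_div_iff₀ hσ]; linarith
  have hQC : (Q : ℝ) ^ C ≤ (3 / σ) ^ (C + 1) := by
    calc (Q : ℝ) ^ C ≤ (3 / σ) ^ C := by gcongr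
      _ ≤ _ := pow_le_pow_right₀ hK1 (by omega)
  have hqr : (1 : ℝ) ≤ q := by exact_mod_cast hq1
  refine ⟨(p : ℚ) / (q : ℤ), ?_, ?_⟩
  · have h1 := Rat.den_dvd p q
    rw [Rat.divInt_eq_div] at h1
    have h2 : ((p : ℚ) / (q : ℤ)).den ≤ q :=
      Nat.le_of_dvd (by omega) (Int.natCast_dvd_natCast.1 h1)
    have h3 : (((p : ℚ) / (q : ℤ)).den : ℝ) ≤ q := by exact_mod_cast h2
    have h4 : (q : ℝ) ≤ Q ^ C := by exact_mod_cast hq2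
    linarith
  · rw [hcoeff] at hp
    push_cast at hp ⊢
    rw [le_div_iff₀ (by positivity), ← pow_mul] at hp
    refine le_trans ?_ (hp.trans hQC)
    refine mul_le_mul_of_nonneg_right ?_ (by positivity)
    have : q * θ - p = q * (θ - p / q) := by field_simp
    rw [this, abs_mul, Nat.abs_cast]
    exact le_mul_of_one_le_left (abs_nonneg _) hqr

end WeylSums

/-! ### Summing the bounds over dyadic scales. -/

section DyadicBounds

open Finset

theorem one_le_abs_sub_mul_den {r r' : ℚ} (h : r ≠ r') :
    1 ≤ |(r : ℝ) - r'| * (r.den * r'.den) := by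
  have h1 : (r.num : ℝ) = r * r.den := by exact_mod_cast (Rat.mul_den_eq_num r).symm
  have h2 : (r'.num : ℝ) = r' * r'.den := by exact_mod_cast (Rat.mul_den_eq_num r').symm
  have hd : (0 : ℝ) < r.den := by exact_mod_cast r.den_pos
  have hd' : (0 : ℝ) < r'.den := by exact_mod_cast r'.den_pos
  have e : |(r : ℝ) - r'| * (r.den * r'.den)
      = |((r.num * r'.den - r'.num * r.den : ℤ) : ℝ)| := by
    have e1 : ((r.num * r'.den - r'.num * r.den : ℤ) : ℝ)
        = ((r : ℝ) - r') * (r.den * r'.den) := by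
      push_cast; rw [h1, h2]; ring
    rw [e1, abs_mul, abs_of_pos (mul_pos hd hd')]
  rw [e]
  have hne : r.num * r'.den - r'.num * r.den ≠ 0 := by
    intro h0
    apply h
    have h3 : ((r.num * r'.den - r'.num * r.den : ℤ) : ℝ) = 0 := by rw [h0]; simp
    rw [h3, abs_zero, mul_eq_zero, abs_eq_zero] at e
    rcases e with e | e
    · exact_mod_cast sub_eq_zero.1 e
    · exact absurd e (mul_pos hd hd').ne'
  have := Int.one_le_abs hne
  exact_mod_cast this

/-- Two rationals with denominators of the same dyadic size approximating the same number at
sufficiently large scales coincide. -/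
theorem eq_of_dyadic_approx {n : ℕ} (hn : 1 ≤ n) {θ : ℝ} {r r' : ℚ} {i j : ℕ} (hi : 9 ≤ i)
    (hij : i ≤ j) (hlog : Nat.log 2 r.den = Nat.log 2 r'.den)
    (hr : (r.den : ℝ) ^ 4 ≤ 2 ^ i) (hβ : (|θ - r| * 2 ^ (i * n)) ^ 4 ≤ 2 ^ i)
    (hβ' : (|θ - r'| * 2 ^ (j * n)) ^ 4 ≤ 2 ^ j) : r = r' := by
  by_contra hne
  have h1 := one_le_abs_sub_mul_den hne
  -- With `u = τ^i = 2^(i/4)` the denominators are at most `u` and `2u` and both errors at most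
  -- `u⁻³`. Distinct rationals would give `1 ≤ 4 / u`, but `i ≥ 9` forces `u > 4`.
  set τ : ℝ := (2 : ℝ) ^ (1 / 4 : ℝ) with hτ
  have hτ4 : τ ^ 4 = 2 := by
    rw [hτ, ← Real.rpow_natCast, ← Real.rpow_mul (by norm_num)]; norm_num
  have hτ0 : 0 < τ := by positivity
  have hτ1 : 1 ≤ τ := by
    by_contra h
    push Not at h
    have := pow_lt_one₀ hτ0.le h (n := 4) (by norm_num)
    linarith
  have hp : ∀ k : ℕ, (2 : ℝ) ^ k = (τ ^ k) ^ 4 := fun k => by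
    rw [← pow_mul, mul_comm, pow_mul, hτ4]
  have key : ∀ (k : ℕ) (y : ℝ), 0 ≤ y → y ^ 4 ≤ 2 ^ k → y ≤ τ ^ k := fun k y hy h => by
    rw [hp] at h
    exact le_of_pow_le_pow_left₀ (by norm_num) (by positivity) h
  have approx : ∀ (k : ℕ) (β : ℝ), 0 ≤ β → (β * 2 ^ (k * n)) ^ 4 ≤ 2 ^ k → β * (τ ^ k) ^ 3 ≤ 1 := by
    intro k β hβ0 h
    have h2 := key k _ (by positivity) h
    have h3 : (2 : ℝ) ^ k ≤ 2 ^ (k * n) :=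
      pow_le_pow_right₀ (by norm_num) (Nat.le_mul_of_pos_right _ hn)
    have h4 : β * (τ ^ k) ^ 3 * τ ^ k ≤ 1 * τ ^ k := by
      calc β * (τ ^ k) ^ 3 * τ ^ k = β * (τ ^ k) ^ 4 := by ring
        _ = β * 2 ^ k := by rw [← hp]
        _ ≤ β * 2 ^ (k * n) := by gcongr
        _ ≤ 1 * τ ^ k := by linarith
    exact le_of_mul_le_mul_right h4 (by positivity)
  have hq := key i _ (Nat.cast_nonneg _) hr
  have hb := approx i _ (abs_nonneg _) hβ
  have hb' := approx j _ (abs_nonneg _) hβ'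
  have hu : 4 < τ ^ i := by
    have h5 : (4 : ℝ) ^ 4 < (τ ^ i) ^ 4 := by
      rw [← hp]
      calc (4 : ℝ) ^ 4 < 2 ^ 9 := by norm_num
        _ ≤ 2 ^ i := pow_le_pow_right₀ (by norm_num) hi
    exact lt_of_pow_lt_pow_left₀ 4 (by positivity) h5
  have huv : τ ^ i ≤ τ ^ j := pow_le_pow_right₀ hτ1 hij
  set u := τ ^ i
  have hu0 : 0 < u := by linarith
  have hb2 : |θ - r'| * u ^ 3 ≤ 1 := by
    refine le_trans ?_ hb'
    gcongr
  have hq' : (r'.den : ℝ) ≤ 2 * u := by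
    have h6 : r'.den < 2 ^ (Nat.log 2 r'.den + 1) := Nat.lt_pow_succ_log_self (by norm_num) _
    have h7 : 2 ^ Nat.log 2 r.den ≤ r.den := Nat.pow_log_le_self 2 r.den_nz
    rw [← hlog, pow_succ] at h6
    have h8 : r'.den ≤ 2 * r.den := by omega
    have h9 : (r'.den : ℝ) ≤ 2 * r.den := by exact_mod_cast h8
    linarith
  have htri : |(r : ℝ) - r'| ≤ |θ - r| + |θ - r'| := by
    calc |(r : ℝ) - r'| = |(θ - r') - (θ - r)| := by ring_nf
      _ ≤ |θ - r'| + |θ - r| := abs_sub _ _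
      _ = _ := add_comm _ _
  have h10 : 1 ≤ (|θ - r| + |θ - r'|) * (u * (2 * u)) := by
    refine h1.trans ?_
    gcongr
  have h11 : (|θ - r| + |θ - r'|) * (u * (2 * u)) * u ≤ 4 := by
    calc _ = 2 * (|θ - r| * u ^ 3 + |θ - r'| * u ^ 3) := by ring
      _ ≤ 4 := by linarith
  nlinarith

/-- The bounds provided by Weyl's inequality and by the comparison with rational points sum up
to a constant over all dyadic scales. -/
theorem sum_le_of_dyadic_rational_approx {n C : ℕ} (hn : 1 ≤ n) (hC : 1 ≤ C) {B : ℝ}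
    (hB : 0 ≤ B) : ∃ A : ℝ, ∀ (θ : ℝ) (σ : ℕ → ℝ) (r : ℕ → ℚ),
    (∀ j, 0 ≤ σ j) → (∀ j, σ j ≤ 1) →
    (∀ j, 0 < σ j → ((r j).den : ℝ) ≤ (3 / σ j) ^ C) →
    (∀ j, 0 < σ j → |θ - r j| * 2 ^ (j * n) ≤ (3 / σ j) ^ C) →
    (∀ j, σ j * 2 ^ j ≤ (r j).den + 2 ^ j * (B * (|θ - r j| * 2 ^ (j * n)))) →
    ∀ J, ∑ j ∈ range J, σ j ≤ A := by
  have hC0 : (0 : ℝ) < C := by exact_mod_cast hC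
  have hn0 : (0 : ℝ) < n := by exact_mod_cast hn
  obtain ⟨ρ, hρ0, hρ1, hρC⟩ : ∃ ρ : ℝ, 0 < ρ ∧ ρ < 1 ∧ ρ ^ (4 * C) = 1 / 2 := by
    refine ⟨(1 / 2 : ℝ) ^ (1 / (4 * C : ℝ)), by positivity,
      Real.rpow_lt_one (by norm_num) (by norm_num) (by positivity), ?_⟩
    rw [← Real.rpow_natCast, ← Real.rpow_mul (by norm_num)]
    push_cast
    rw [one_div_mul_cancel (by positivity), Real.rpow_one]
  obtain ⟨lam, hl0, hl1, hlC⟩ : ∃ lam : ℝ, 0 < lam ∧ lam < 1 ∧ lam ^ (2 * C) = 1 / 2 := by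
    refine ⟨(1 / 2 : ℝ) ^ (1 / (2 * C : ℝ)), by positivity,
      Real.rpow_lt_one (by norm_num) (by norm_num) (by positivity), ?_⟩
    rw [← Real.rpow_natCast, ← Real.rpow_mul (by norm_num)]
    push_cast
    rw [one_div_mul_cancel (by positivity), Real.rpow_one]
  obtain ⟨R, hR1, hRC⟩ : ∃ R : ℝ, 1 < R ∧ R ^ (2 * C) = 2 ^ n := by
    refine ⟨((2 : ℝ) ^ n) ^ (1 / (2 * C : ℝ)),
      Real.one_lt_rpow (one_lt_pow₀ (by norm_num) (by omega)) (by positivity), ?_⟩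
    rw [← Real.rpow_natCast (_ ^ _), ← Real.rpow_mul (by positivity)]
    push_cast
    rw [one_div_mul_cancel (by positivity), Real.rpow_one]
  set G : ℝ := 3 ^ C * (2 * B + 3 ^ C) with hG
  have hG1 : 1 ≤ G := by
    have : (1 : ℝ) ≤ 3 ^ C := one_le_pow₀ (by norm_num)
    nlinarith
  have hR0 : 0 < R := by linarith
  have hl2 : 0 < 1 - lam := by linarith
  refine ⟨9 + 3 * (1 - ρ)⁻¹ + G * ((1 - lam)⁻¹ * (2 * (1 + R) / (R - 1))), ?_⟩
  intro θ σ r hσ0 hσ1 hden hβ hσ J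
  -- The major scales. Elsewhere, from `j = 9` on, either `σ j = 0` or the failed inequality reads
  -- `σ j < 3 * 2^(-j/(4C)) = 3 * ρ^j`.
  set M : Set ℕ := {j | 9 ≤ j ∧ 0 < σ j ∧ ((3 / σ j) ^ C) ^ 4 ≤ 2 ^ j} with hM
  set s : ℕ → ℕ := fun j => Nat.log 2 (r j).den with hs
  have hMden : ∀ j ∈ M, ((r j).den : ℝ) ^ 4 ≤ 2 ^ j := fun j hj =>
    (pow_le_pow_left₀ (Nat.cast_nonneg _) (hden j hj.2.1) 4).trans hj.2.2
  have hMβ : ∀ j ∈ M, (|θ - r j| * 2 ^ (j * n)) ^ 4 ≤ 2 ^ j := fun j hj =>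
    (pow_le_pow_left₀ (by positivity) (hβ j hj.2.1) 4).trans hj.2.2
  -- On major scales the rational depends only on the dyadic size of its denominator.
  obtain ⟨f, hf⟩ : ∃ f : ℕ → ℚ, ∀ j ∈ M, r j = f (s j) := by
    classical
    refine ⟨fun t => if h : ∃ j ∈ M, s j = t then r h.choose else 0, fun j hj => ?_⟩
    have h : ∃ j' ∈ M, s j' = s j := ⟨j, hj, rfl⟩
    dsimp only
    rw [dif_pos h]
    obtain ⟨hc1, hc2⟩ := h.choose_spec
    rcases le_total j h.choose with hle | hle
    · exact eq_of_dyadic_approx hn hj.1 hle hc2.symm (hMden j hj) (hMβ j hj) (hMβ _ hc1)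
    · exact (eq_of_dyadic_approx hn hc1.1 hle hc2 (hMden _ hc1) (hMβ _ hc1) (hMβ j hj)).symm
  -- The `2C`-th root of `|θ - f t| * 2^(jn)`, which is geometric in `j` with ratio `R`.
  set Y : ℕ → ℕ → ℝ := fun t j => |θ - f t| ^ (1 / (2 * C : ℝ)) * R ^ j with hY
  have hY0 : ∀ t j, 0 ≤ Y t j := fun t j => by positivity
  have hmin0 : ∀ t j, 0 ≤ min (Y t j) (Y t j)⁻¹ := fun t j =>
    le_min (hY0 t j) (inv_nonneg.2 (hY0 t j))
  have hYC : ∀ t j, Y t j ^ (2 * C) = |θ - f t| * 2 ^ (j * n) := by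
    intro t j
    rw [hY]
    dsimp only
    rw [mul_pow, ← Real.rpow_natCast (_ ^ _), ← Real.rpow_mul (abs_nonneg _)]
    push_cast
    rw [one_div_mul_cancel (by positivity), Real.rpow_one, ← pow_mul, mul_comm j (2 * C), pow_mul,
      hRC, ← pow_mul, mul_comm n j]
  have hρj : ∀ j : ℕ, (ρ ^ j) ^ (4 * C) * 2 ^ j = 1 := by
    intro j
    rw [← pow_mul, mul_comm j, pow_mul, hρC, ← mul_pow]; norm_num
  have hminor : ∀ j, j ∉ M → 9 ≤ j → σ j ≤ 3 * ρ ^ j := by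
    intro j hj h9
    rcases (hσ0 j).eq_or_lt with h0 | h0
    · rw [← h0]; positivity
    have h1 : (2 : ℝ) ^ j < ((3 / σ j) ^ C) ^ 4 := by
      by_contra h
      exact hj ⟨h9, h0, not_lt.1 h⟩
    rw [← pow_mul, mul_comm C 4, div_pow, lt_div_iff₀ (by positivity)] at h1
    refine le_of_pow_le_pow_left₀ (n := 4 * C) (by omega) (by positivity) ?_
    rw [mul_pow]
    have h2 : σ j ^ (4 * C) = (ρ ^ j) ^ (4 * C) * (2 ^ j * σ j ^ (4 * C)) := by
      rw [← mul_assoc, hρj, one_mul]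
    rw [h2, mul_comm]
    gcongr
  have hmajor : ∀ j ∈ M,
      σ j ≤ 2 * ρ ^ j + G * (lam ^ s j * min (Y (s j) j) (Y (s j) j)⁻¹) := by
    intro j hj
    have hσj := hj.2.1
    have hrest : 0 ≤ G * (lam ^ s j * min (Y (s j) j) (Y (s j) j)⁻¹) :=
      mul_nonneg (by linarith) (mul_nonneg (by positivity) (hmin0 _ _))
    set y := |θ - r j| * 2 ^ (j * n) with hy
    have hy0 : 0 ≤ y := by positivity
    have hq : ((r j).den : ℝ) ≤ 2 ^ j * ρ ^ j := by
      have h1 : (1 : ℝ) ≤ (2 ^ j) ^ 2 := one_le_pow₀ (one_le_pow₀ (by norm_num))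
      refine le_of_pow_le_pow_left₀ (n := 4) (by norm_num) (by positivity) ?_
      refine (hMden j hj).trans ?_
      have h2 : (ρ ^ j) ^ (4 * C) ≤ (ρ ^ j) ^ 4 :=
        pow_le_pow_of_le_one (by positivity) (pow_le_one₀ hρ0.le hρ1.le) (by omega)
      have h3 : (1 : ℝ) ≤ (ρ ^ j) ^ 4 * 2 ^ j := by
        rw [← hρj j]; gcongr
      rw [mul_pow]
      calc (2 : ℝ) ^ j = 2 ^ j * (1 * 1) := by ring
        _ ≤ 2 ^ j * ((2 ^ j) ^ 2 * ((ρ ^ j) ^ 4 * 2 ^ j)) := by gcongr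
        _ = _ := by ring
    have h1 : σ j ≤ ρ ^ j + B * y := by
      have h2 : σ j * 2 ^ j ≤ (ρ ^ j + B * y) * 2 ^ j := by linarith [hσ j]
      exact le_of_mul_le_mul_right h2 (by positivity)
    rcases le_total (B * y) (ρ ^ j) with hcase | hcase
    · linarith
    have h2 : σ j ≤ 2 * B * y := by linarith
    have h3 : σ j ^ C ≤ 2 * B * y := (pow_le_of_le_one hσj.le (hσ1 j) (by omega)).trans h2
    have h4 : σ j ^ C * (r j).den ≤ 3 ^ C := by
      have := hden j hσj
      rw [div_pow, le_div_iff₀ (by positivity)] at this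
      linarith
    have h5 : σ j ^ C * y ≤ 3 ^ C := by
      have := hβ j hσj
      rw [div_pow, le_div_iff₀ (by positivity)] at this
      linarith
    have hB2 : 0 ≤ 2 * B := by linarith
    have h3C : (0 : ℝ) ≤ 3 ^ C := by positivity
    have hypos : 0 < y := by
      rcases hy0.eq_or_lt with h | h
      · rw [← h] at h2; linarith
      · exact h
    have h6 : σ j ^ C ≤ (2 * B + 3 ^ C) * min y y⁻¹ := by
      rw [mul_min_of_nonneg _ _ (by linarith), le_min_iff]
      constructor
      · nlinarith
      · rw [← div_eq_mul_inv, le_div_iff₀ hypos]; linarith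
    -- One factor `σ^C` pays for the denominator, the other for the decay in `y` on both sides of
    -- `1`. A `2C`-th root then gives decay both in `s j` and in the distance of `Y` from `1`.
    have h7 : σ j ^ (2 * C) * (r j).den ≤ G * min y y⁻¹ := by
      calc σ j ^ (2 * C) * (r j).den = σ j ^ C * (r j).den * σ j ^ C := by
            rw [two_mul, pow_add]; ring
        _ ≤ 3 ^ C * ((2 * B + 3 ^ C) * min y y⁻¹) := by gcongr
        _ = _ := by rw [hG]; ring
    have h8 : (1 : ℝ) ≤ (r j).den * (1 / 2) ^ s j := by
      have h9 : 2 ^ s j ≤ (r j).den := Nat.pow_log_le_self 2 (r j).den_nz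
      have h10 : (2 : ℝ) ^ s j ≤ (r j).den := by exact_mod_cast h9
      calc (1 : ℝ) = 2 ^ s j * (1 / 2) ^ s j := by rw [← mul_pow]; norm_num
        _ ≤ (r j).den * (1 / 2) ^ s j := by gcongr
    have hYy : Y (s j) j ^ (2 * C) = y := by rw [hYC, ← hf j hj]
    have h9 : min y y⁻¹ ≤ (min (Y (s j) j) (Y (s j) j)⁻¹) ^ (2 * C) := by
      rcases min_choice (Y (s j) j) (Y (s j) j)⁻¹ with h | h <;> rw [h]
      · rw [hYy]; exact min_le_left _ _
      · rw [inv_pow, hYy]; exact min_le_right _ _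
    have h10 : σ j ^ (2 * C) ≤ (G * (lam ^ s j * min (Y (s j) j) (Y (s j) j)⁻¹)) ^ (2 * C) := by
      have hGp : G ≤ G ^ (2 * C) := le_self_pow₀ hG1 (by omega)
      have hlp : (lam ^ s j) ^ (2 * C) = (1 / 2) ^ s j := by
        rw [← pow_mul, mul_comm, pow_mul, hlC]
      rw [mul_pow G, mul_pow (lam ^ s j), hlp]
      have hmy : 0 ≤ min y y⁻¹ := le_min hy0 (inv_nonneg.2 hy0)
      calc σ j ^ (2 * C) = σ j ^ (2 * C) * 1 := by ring
        _ ≤ σ j ^ (2 * C) * ((r j).den * (1 / 2) ^ s j) := by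
            gcongr
        _ = σ j ^ (2 * C) * (r j).den * (1 / 2) ^ s j := by ring
        _ ≤ G * min y y⁻¹ * (1 / 2) ^ s j := by gcongr
        _ ≤ G ^ (2 * C) * (min (Y (s j) j) (Y (s j) j)⁻¹) ^ (2 * C) * (1 / 2) ^ s j := by gcongr
        _ = _ := by ring
    have h11 := le_of_pow_le_pow_left₀ (n := 2 * C) (by omega) hrest h10
    have : 0 < ρ ^ j := by positivity
    linarith
  have hbound : ∀ j ∈ range J, σ j ≤ (if j ∈ range 9 then (1 : ℝ) else 0) + 3 * ρ ^ j
      + G * ∑ t ∈ range J, lam ^ t * min (Y t j) (Y t j)⁻¹ := by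
    intro j hj
    have hρp : 0 < ρ ^ j := by positivity
    have hsum : 0 ≤ G * ∑ t ∈ range J, lam ^ t * min (Y t j) (Y t j)⁻¹ :=
      mul_nonneg (by linarith) (sum_nonneg fun t _ => mul_nonneg (by positivity) (hmin0 _ _))
    by_cases h9 : 9 ≤ j
    · have hite : (if j ∈ range 9 then (1 : ℝ) else 0) = 0 := by
        rw [if_neg]; simpa using h9
      rw [hite]
      by_cases hjM : j ∈ M
      · have hsJ : s j ∈ range J := by
          have h1 : (r j).den ≤ 2 ^ j := by
            have h2 := hMden j hjM
            have h3 : (r j).den ^ 4 ≤ 2 ^ j := by exact_mod_cast h2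
            exact (Nat.le_self_pow (by norm_num) _).trans h3
          have h4 : s j ≤ j := by
            have := Nat.log_mono_right (b := 2) h1
            rwa [Nat.log_pow (by norm_num)] at this
          rw [mem_range] at hj ⊢
          omega
        have h5 := single_le_sum (f := fun t => lam ^ t * min (Y t j) (Y t j)⁻¹)
          (fun t _ => mul_nonneg (by positivity) (hmin0 _ _)) hsJ
        have h6 := mul_le_mul_of_nonneg_left h5 (by linarith : 0 ≤ G)
        have h7 := hmajor j hjM
        linarith
      · linarith [hminor j hjM h9]
    · have hite : (if j ∈ range 9 then (1 : ℝ) else 0) = 1 := by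
        rw [if_pos]; simpa using h9
      rw [hite]
      linarith [hσ1 j]
  refine (sum_le_sum hbound).trans ?_
  rw [sum_add_distrib, sum_add_distrib, ← mul_sum, ← mul_sum]
  refine add_le_add (add_le_add ?_ ?_) ?_
  · rw [sum_ite_mem, sum_const, nsmul_eq_mul, mul_one]
    have : #(range J ∩ range 9) ≤ 9 := (card_le_card inter_subset_right).trans (by simp)
    exact_mod_cast this
  · have := sum_geometric_le hρ0.le hρ1 J
    linarith
  · refine mul_le_mul_of_nonneg_left ?_ (by linarith)
    rw [sum_comm]
    calc ∑ t ∈ range J, ∑ j ∈ range J, lam ^ t * min (Y t j) (Y t j)⁻¹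
        ≤ ∑ t ∈ range J, lam ^ t * (2 * (1 + R) / (R - 1)) := by
          refine sum_le_sum fun t _ => ?_
          rw [← mul_sum]
          exact mul_le_mul_of_nonneg_left
            (sum_min_geometric_le (by positivity) hR1 J) (by positivity)
      _ = (∑ t ∈ range J, lam ^ t) * (2 * (1 + R) / (R - 1)) := by rw [sum_mul]
      _ ≤ _ := by
          have : 0 < R - 1 := by linarith
          exact mul_le_mul_of_nonneg_right (sum_geometric_le hl0.le hl1 J) (by positivity)

/-- Here `σ j` is the exact normalised maximum over subintervals of the block, so that the inverse
Weyl inequality applies to an extremal one. -/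
theorem exists_dyadicSineBound_odd {n : ℕ} (hn : Odd n) : ∃ A : ℝ, ∀ x : ℝ,
    ∃ σ, DyadicSineBound (n : ℝ) x σ ∧ ∀ J, ∑ j ∈ range J, σ j ≤ A := by
  have hn1 : 1 ≤ n := hn.pos
  obtain ⟨C, hC1, hC⟩ := exists_rational_approx_of_sine_sum hn1
  obtain ⟨A, hA⟩ := sum_le_of_dyadic_rational_approx hn1 hC1
    (B := 2 * Real.pi * 2 ^ n) (by positivity)
  refine ⟨A, fun x => ?_⟩
  have hmax : ∀ j : ℕ, ∃ a b : ℕ, 2 ^ j ≤ a ∧ b ≤ 2 ^ (j + 1) ∧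
      ∀ a' b' : ℕ, 2 ^ j ≤ a' → a' ≤ b' → b' ≤ 2 ^ (j + 1) →
        |∑ k ∈ Ico a' b', Real.sin ((k : ℝ) ^ n * x)|
          ≤ |∑ k ∈ Ico a b, Real.sin ((k : ℝ) ^ n * x)| := by
    intro j
    have hle : 2 ^ j ≤ 2 ^ (j + 1) := Nat.pow_le_pow_right (by norm_num) (by omega)
    obtain ⟨⟨a, b⟩, hab, hm⟩ := exists_max_image
      (Icc (2 ^ j) (2 ^ (j + 1)) ×ˢ Icc (2 ^ j) (2 ^ (j + 1)))
      (fun ab : ℕ × ℕ => |∑ k ∈ Ico ab.1 ab.2, Real.sin ((k : ℝ) ^ n * x)|)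
      ⟨(2 ^ j, 2 ^ j), by simp [hle]⟩
    rw [mem_product, mem_Icc, mem_Icc] at hab
    refine ⟨a, b, hab.1.1, hab.2.2, fun a' b' h1 h2 h3 => hm (a', b') ?_⟩
    rw [mem_product, mem_Icc, mem_Icc]
    exact ⟨⟨h1, h2.trans h3⟩, h1.trans h2, h3⟩
  choose a b ha hb hab using hmax
  set σ : ℕ → ℝ := fun j => |∑ k ∈ Ico (a j) (b j), Real.sin ((k : ℝ) ^ n * x)| / 2 ^ j with hσ
  have hσS : ∀ j, σ j * 2 ^ j = |∑ k ∈ Ico (a j) (b j), Real.sin ((k : ℝ) ^ n * x)| := fun j => by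
    rw [hσ]; exact div_mul_cancel₀ _ (by positivity)
  have hr : ∀ j, ∃ r : ℚ, 0 < σ j → (r.den : ℝ) ≤ (3 / σ j) ^ C ∧
        |x / (2 * Real.pi) - r| * 2 ^ (j * n) ≤ (3 / σ j) ^ C := by
    intro j
    by_cases h : 0 < σ j
    · obtain ⟨r, hr⟩ := hC x (σ j) j (a j) (b j) (ha j) (hb j) h (hσS j)
      exact ⟨r, fun _ => hr⟩
    -- If `σ j = 0` any rational will do, since the comparison near a rational holds for all of
    -- them.
    · exact ⟨0, fun h' => absurd h' h⟩
  choose r hr using hr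
  refine ⟨σ, fun j a' b' h1 h2 h3 => ?_, ?_⟩
  · simp only [Real.rpow_natCast]
    rw [hσS]
    exact hab j a' b' h1 h2 h3
  · refine hA (x / (2 * Real.pi)) σ r (fun j => by positivity) (fun j => ?_)
      (fun j h => (hr j h).1) (fun j h => (hr j h).2) (fun j => ?_)
    · rw [hσ]
      exact div_le_one_of_le₀ (abs_sum_sin_le_two_pow _ (ha j) (hb j)) (by positivity)
    · rw [hσS]
      exact abs_sum_sin_le_near_rational hn x (r j) (ha j) (hb j)

/-! ### Kusmin–Landau, van der Corput, and real exponents below two. -/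

theorem norm_sum_antitone_mul_sub_le {g : ℕ → ℝ} {z : ℕ → ℂ} {G : ℝ} (hG : 0 ≤ G)
    (hz : ∀ k, ‖z k‖ ≤ 1) {a b : ℕ} (hg : ∀ k ∈ Ico a b, |g k| ≤ G)
    (hanti : ∀ k, a ≤ k → k + 1 < b → g (k + 1) ≤ g k) :
    ‖∑ k ∈ Ico a b, (g k : ℂ) * (z (k + 1) - z k)‖ ≤ 4 * G := by
  rcases Nat.lt_or_ge a b with hab | hab
  swap
  · rw [Ico_eq_empty (by omega)]; simpa using hG
  have key : ∀ m, a ≤ m → m < b →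
      ‖∑ k ∈ Ico a (m + 1), (g k : ℂ) * (z (k + 1) - z k) - g m * z (m + 1)‖
        ≤ G + (g a - g m) := by
    intro m hm
    induction m, hm using Nat.le_induction with
    | base =>
      intro _
      rw [Nat.Ico_succ_singleton, sum_singleton,
        show (g a : ℂ) * (z (a + 1) - z a) - g a * z (a + 1) = -(g a * z a) by ring, norm_neg,
        norm_mul, Complex.norm_real, Real.norm_eq_abs]
      have := mul_le_mul (hg a (by simp [hab])) (hz a) (norm_nonneg _) hG
      linarith
    | succ m hm ih =>
      intro hmb
      have h1 := ih (by omega)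
      have h2 := hanti m hm hmb
      rw [sum_Ico_succ_top (by omega)]
      have e : ∑ k ∈ Ico a (m + 1), (g k : ℂ) * (z (k + 1) - z k)
            + g (m + 1) * (z (m + 1 + 1) - z (m + 1)) - g (m + 1) * z (m + 1 + 1)
          = (∑ k ∈ Ico a (m + 1), (g k : ℂ) * (z (k + 1) - z k) - g m * z (m + 1))
            + ((g m - g (m + 1) : ℝ) : ℂ) * z (m + 1) := by push_cast; ring
      rw [e]
      refine (norm_add_le _ _).trans ?_
      rw [norm_mul, Complex.norm_real, Real.norm_eq_abs, abs_of_nonneg (by linarith)]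
      have h3 := mul_le_mul_of_nonneg_left (hz (m + 1)) (by linarith : 0 ≤ g m - g (m + 1))
      linarith
  obtain ⟨m, rfl⟩ : ∃ m, b = m + 1 := ⟨b - 1, by omega⟩
  have h1 := key m (by omega) (by omega)
  have h2 := abs_le.1 (hg a (by simp; omega))
  have h3 := hg m (by simp; omega)
  have h4 := abs_le.1 h3
  have h5 : ‖(g m : ℂ) * z (m + 1)‖ ≤ G := by
    rw [norm_mul, Complex.norm_real, Real.norm_eq_abs]
    have := mul_le_mul h3 (hz (m + 1)) (norm_nonneg _) hG
    linarith
  have h6 := norm_add_le (∑ k ∈ Ico a (m + 1), (g k : ℂ) * (z (k + 1) - z k) - g m * z (m + 1))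
    (g m * z (m + 1))
  rw [sub_add_cancel] at h6
  linarith

theorem two_mul_le_sin_pi_mul {Δ δ : ℝ} (hΔ : 0 < Δ) (h1 : Δ ≤ δ) (h2 : δ ≤ 1 - Δ) :
    2 * Δ ≤ Real.sin (Real.pi * δ) := by
  have hpi := Real.pi_pos
  rcases le_total δ (1 / 2) with h | h
  · have := Real.mul_le_sin (x := Real.pi * δ) (by nlinarith) (by nlinarith)
    rw [show 2 / Real.pi * (Real.pi * δ) = 2 * δ by field_simp] at this
    linarith
  · have := Real.mul_le_sin (x := Real.pi * (1 - δ)) (by nlinarith) (by nlinarith)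
    rw [show 2 / Real.pi * (Real.pi * (1 - δ)) = 2 * (1 - δ) by field_simp,
      show Real.pi * (1 - δ) = Real.pi - Real.pi * δ by ring, Real.sin_pi_sub] at this
    linarith

/-- The identity `1 / (e(δ) - 1) = -1/2 - (i/2) cot (πδ)`. It writes `e(f k)` as a difference of
consecutive values times a weight whose variable part is monotone in `δ`, ready for Abel summation.
-/
theorem expTwoPi_sub_one_mul_cot {δ : ℝ} (h : Real.sin (Real.pi * δ) ≠ 0) :
    (-(1 / 2) - Complex.I / 2 * ((Real.cos (Real.pi * δ) / Real.sin (Real.pi * δ) : ℝ) : ℂ))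
      * (expTwoPi δ - 1) = 1 := by
  have hsq := Real.sin_sq_add_cos_sq (Real.pi * δ)
  have he : expTwoPi δ = ((Real.cos (Real.pi * δ) ^ 2 - Real.sin (Real.pi * δ) ^ 2 : ℝ) : ℂ)
      + ((2 * Real.sin (Real.pi * δ) * Real.cos (Real.pi * δ) : ℝ) : ℂ) * Complex.I := by
    rw [← Real.sin_two_mul, ← Real.cos_two_mul', expTwoPi, Complex.exp_mul_I,
      ← Complex.ofReal_cos, ← Complex.ofReal_sin, mul_assoc]
  rw [he]
  set S := Real.sin (Real.pi * δ)
  set K := Real.cos (Real.pi * δ)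
  have hK : ((K ^ 2 - S ^ 2 : ℝ) : ℂ) - 1 = -2 * S ^ 2 := by
    have : K ^ 2 - S ^ 2 - 1 = -2 * S ^ 2 := by linarith
    exact_mod_cast congrArg (fun t : ℝ => (t : ℂ)) this
  have hS : (S : ℂ) ≠ 0 := by exact_mod_cast h
  have hsq' : (S : ℂ) ^ 2 + K ^ 2 = 1 := by exact_mod_cast hsq
  rw [add_sub_right_comm, hK]
  push_cast
  field_simp
  linear_combination hsq' - (K : ℂ) ^ 2 * Complex.I_sq

/-- The Kusmin–Landau inequality. -/
theorem norm_sum_expTwoPi_le_of_monotone_diff {f : ℕ → ℝ} {a b : ℕ} {Δ : ℝ} (hΔ : 0 < Δ) (m : ℤ)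
    (hlo : ∀ k ∈ Ico a b, m + Δ ≤ f (k + 1) - f k)
    (hhi : ∀ k ∈ Ico a b, f (k + 1) - f k ≤ m + 1 - Δ)
    (hmono : ∀ k, a ≤ k → k + 1 < b → f (k + 1) - f k ≤ f (k + 1 + 1) - f (k + 1)) :
    ‖∑ k ∈ Ico a b, expTwoPi (f k)‖ ≤ 1 + 1 / Δ := by
  have hpi := Real.pi_pos
  set δ : ℕ → ℝ := fun k => f (k + 1) - f k - m with hδ
  set g : ℕ → ℝ := fun k => Real.cos (Real.pi * δ k) / Real.sin (Real.pi * δ k) with hg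
  have hsin : ∀ k ∈ Ico a b, 2 * Δ ≤ Real.sin (Real.pi * δ k) := fun k hk =>
    two_mul_le_sin_pi_mul hΔ (by have := hlo k hk; simp only [hδ]; linarith)
      (by have := hhi k hk; simp only [hδ]; linarith)
  have hpt : ∀ k ∈ Ico a b, expTwoPi (f k)
      = -(1 / 2) * (expTwoPi (f (k + 1)) - expTwoPi (f k))
        - Complex.I / 2 * ((g k : ℂ) * (expTwoPi (f (k + 1)) - expTwoPi (f k))) := by
    intro k hk
    have h1 := expTwoPi_sub_one_mul_cot (δ := δ k) (by linarith [hsin k hk])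
    have h2 : expTwoPi (f (k + 1)) = expTwoPi (f k) * expTwoPi (δ k) := by
      rw [hδ, expTwoPi_sub_intCast, ← expTwoPi_add]; congr 1; ring
    change (-(1 / 2) - Complex.I / 2 * (g k : ℂ)) * (expTwoPi (δ k) - 1) = 1 at h1
    rw [h2]
    linear_combination (-expTwoPi (f k)) * h1
  rw [sum_congr rfl hpt, sum_sub_distrib, ← mul_sum, ← mul_sum]
  have hG : ‖∑ k ∈ Ico a b, (g k : ℂ) * (expTwoPi (f (k + 1)) - expTwoPi (f k))‖
      ≤ 4 * (1 / (2 * Δ)) := by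
    refine norm_sum_antitone_mul_sub_le (z := fun k => expTwoPi (f k)) (by positivity)
      (fun k => (norm_expTwoPi _).le) (fun k hk => ?_) (fun k hk1 hk2 => ?_)
    · have h1 := hsin k hk
      have h2 : 0 < Real.sin (Real.pi * δ k) := by linarith
      rw [hg, abs_div, abs_of_pos h2]
      exact div_le_div₀ (by norm_num) (Real.abs_cos_le_one _) (by positivity) h1
    · have hk : k ∈ Ico a b := mem_Ico.2 ⟨hk1, by omega⟩
      have hk' : k + 1 ∈ Ico a b := mem_Ico.2 ⟨by omega, hk2⟩
      have h1 : 0 < Real.sin (Real.pi * δ k) := by linarith [hsin k hk]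
      have h2 : 0 < Real.sin (Real.pi * δ (k + 1)) := by linarith [hsin _ hk']
      rw [hg]
      dsimp only
      rw [div_le_div_iff₀ h2 h1]
      have h3 : 0 ≤ Real.sin (Real.pi * δ (k + 1) - Real.pi * δ k) := by
        have h4 := hmono k hk1 hk2
        have h5 := hlo k hk
        have h6 := hhi _ hk'
        have h7 : 0 ≤ δ (k + 1) - δ k := by simp only [hδ]; linarith
        have h8 : δ (k + 1) - δ k ≤ 1 := by simp only [hδ]; linarith
        apply Real.sin_nonneg_of_nonneg_of_le_pi <;> nlinarith
      rw [Real.sin_sub] at h3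
      linarith
  have hT : ‖∑ k ∈ Ico a b, (expTwoPi (f (k + 1)) - expTwoPi (f k))‖ ≤ 2 := by
    rcases Nat.lt_or_ge a b with hab | hab
    · rw [sum_Ico_sub (fun k => expTwoPi (f k)) hab.le]
      refine (norm_sub_le _ _).trans ?_
      rw [norm_expTwoPi, norm_expTwoPi]; norm_num
    · rw [Ico_eq_empty (by omega)]; simp
  refine (norm_sub_le _ _).trans ?_
  rw [norm_mul, norm_mul, norm_neg, norm_div, norm_div, norm_one, Complex.norm_I, Complex.norm_ofNat]
  have e : 4 * (1 / (2 * Δ)) = 2 * (1 / Δ) := by field_simp; norm_num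
  linarith

theorem exists_eq_Ico_of_ordConnected {F : Finset ℕ}
    (hF : ∀ i ∈ F, ∀ k ∈ F, ∀ j, i ≤ j → j ≤ k → j ∈ F) : ∃ a b, F = Ico a b := by
  rcases F.eq_empty_or_nonempty with rfl | hne
  · exact ⟨0, 0, by simp⟩
  · refine ⟨F.min' hne, F.max' hne + 1, ?_⟩
    ext j
    rw [mem_Ico, Nat.lt_succ_iff]
    exact ⟨fun hj => ⟨F.min'_le _ hj, F.le_max' _ hj⟩,
      fun hj => hF _ (F.min'_mem hne) _ (F.max'_mem hne) j hj.1 hj.2⟩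

/-- The van der Corput second derivative test, in terms of second differences. -/
theorem norm_sum_expTwoPi_le_of_second_diff {f : ℕ → ℝ} {a b : ℕ} (hab : a ≤ b) {lam μ Δ : ℝ}
    (hl : 0 < lam) (hμ : 0 ≤ μ) (hΔ : 0 < Δ)
    (hlo : ∀ k, a ≤ k → k + 1 < b → lam ≤ (f (k + 1 + 1) - f (k + 1)) - (f (k + 1) - f k))
    (hhi : ∀ k, a ≤ k → k + 1 < b → (f (k + 1 + 1) - f (k + 1)) - (f (k + 1) - f k) ≤ μ) :
    ‖∑ k ∈ Ico a b, expTwoPi (f k)‖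
      ≤ (((b : ℝ) - a) * μ + 2) * (2 * (Δ / lam + 1) + (1 + 1 / Δ)) := by
  have hab' : (0 : ℝ) ≤ (b : ℝ) - a := by
    have : (a : ℝ) ≤ b := by exact_mod_cast hab
    linarith
  rcases hab.eq_or_lt with rfl | hlt
  · simp; positivity
  set D : ℕ → ℝ := fun k => f (k + 1) - f k with hD
  have hDlo : ∀ i, a ≤ i → ∀ k, i ≤ k → k < b → D i + ((k : ℝ) - i) * lam ≤ D k := by
    intro i hi k hk
    induction k, hk using Nat.le_induction with
    | base => intro _; simp
    | succ k hk ih =>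
      intro hkb
      have h1 := ih (by omega)
      have h2 := hlo k (by omega) hkb
      simp only [hD] at h1 ⊢
      push_cast
      linarith
  have hDhi : ∀ i, a ≤ i → ∀ k, i ≤ k → k < b → D k ≤ D i + ((k : ℝ) - i) * μ := by
    intro i hi k hk
    induction k, hk using Nat.le_induction with
    | base => intro _; simp
    | succ k hk ih =>
      intro hkb
      have h1 := ih (by omega)
      have h2 := hhi k (by omega) hkb
      simp only [hD] at h1 ⊢
      push_cast
      linarith
  have hDmono : ∀ i k, a ≤ i → i ≤ k → k < b → D i ≤ D k := by
    intro i k hi hik hk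
    have h1 := hDlo i hi k hik hk
    have h2 : (i : ℝ) ≤ k := by exact_mod_cast hik
    nlinarith
  have hcard : ∀ (F : Finset ℕ) (u : ℝ), F ⊆ Ico a b → (∀ k ∈ F, u ≤ D k ∧ D k ≤ u + Δ) →
      (#F : ℝ) ≤ Δ / lam + 1 := by
    intro F u hF hu
    rcases F.eq_empty_or_nonempty with rfl | hne
    · simp; positivity
    have hmin := F.min'_mem hne
    have hmax := F.max'_mem hne
    have hle := F.min'_le _ hmax
    have h1 := hDlo _ (mem_Ico.1 (hF hmin)).1 _ hle (mem_Ico.1 (hF hmax)).2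
    have h2 := (hu _ hmin).1
    have h3 := (hu _ hmax).2
    have h4 : #F ≤ F.max' hne + 1 - F.min' hne := by
      rw [← Nat.card_Icc]
      exact card_le_card fun y hy => mem_Icc.2 ⟨F.min'_le _ hy, F.le_max' _ hy⟩
    have h5 : (#F : ℝ) + F.min' hne ≤ F.max' hne + 1 := by
      exact_mod_cast (by omega : #F + F.min' hne ≤ F.max' hne + 1)
    have h6 : ((F.max' hne : ℝ) - F.min' hne) ≤ Δ / lam := by
      rw [le_div_iff₀ hl]; linarith
    linarith
  have hnormcard : ∀ F : Finset ℕ, ‖∑ k ∈ F, expTwoPi (f k)‖ ≤ #F := by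
    intro F
    refine (norm_sum_le _ _).trans ?_
    simp [norm_expTwoPi]
  -- Fix the integer part of the first difference. The terms within `Δ` of an integer are few, as
  -- the differences grow by at least `lam`; the others form an interval to which Kusmin–Landau
  -- applies.
  have hfiber : ∀ m : ℤ, ‖∑ k ∈ Ico a b with ⌊D k⌋ = m, expTwoPi (f k)‖
      ≤ 2 * (Δ / lam + 1) + (1 + 1 / Δ) := by
    intro m
    set F := (Ico a b).filter (fun k => ⌊D k⌋ = m) with hF
    have hFD : ∀ k ∈ F, k ∈ Ico a b ∧ (m : ℝ) ≤ D k ∧ D k < m + 1 := by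
      intro k hk
      rw [hF, mem_filter, Int.floor_eq_iff] at hk
      exact hk
    rw [← sum_filter_add_sum_filter_not F (fun k => D k < m + Δ),
      ← sum_filter_add_sum_filter_not (F.filter fun k => ¬ D k < m + Δ)
        (fun k => m + 1 - Δ < D k)]
    set F₁ := F.filter fun k => D k < m + Δ with hF₁
    set F₂ := (F.filter fun k => ¬ D k < m + Δ).filter fun k => m + 1 - Δ < D k with hF₂
    set F₃ := (F.filter fun k => ¬ D k < m + Δ).filter fun k => ¬ m + 1 - Δ < D k with hF₃
    have c1 : (#F₁ : ℝ) ≤ Δ / lam + 1 := by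
      refine hcard F₁ m (fun k hk => (hFD k (mem_filter.1 hk).1).1) fun k hk => ?_
      rw [hF₁, mem_filter] at hk
      exact ⟨(hFD k hk.1).2.1, hk.2.le⟩
    have c2 : (#F₂ : ℝ) ≤ Δ / lam + 1 := by
      refine hcard F₂ (m + 1 - Δ) (fun k hk => ?_) fun k hk => ?_
      · rw [hF₂, mem_filter, mem_filter] at hk
        exact (hFD k hk.1.1).1
      · rw [hF₂, mem_filter, mem_filter] at hk
        have := (hFD k hk.1.1).2.2
        exact ⟨hk.2.le, by linarith⟩
    have hF₃mem : ∀ k, k ∈ F₃ ↔ k ∈ Ico a b ∧ (m : ℝ) ≤ D k ∧ D k < m + 1 ∧ m + Δ ≤ D k ∧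
        D k ≤ m + 1 - Δ := by
      intro k
      rw [hF₃, hF, mem_filter, mem_filter, mem_filter, Int.floor_eq_iff, not_lt, not_lt]
      tauto
    obtain ⟨a', b', he⟩ := exists_eq_Ico_of_ordConnected (F := F₃) (by
      intro i hi k hk j hij hjk
      rw [hF₃mem, mem_Ico] at hi hk ⊢
      have h1 := hDmono i j (by omega) hij (by omega)
      have h2 := hDmono j k (by omega) hjk (by omega)
      exact ⟨⟨by omega, by omega⟩, by linarith, by linarith, by linarith, by linarith⟩)
    have c3 : ‖∑ k ∈ F₃, expTwoPi (f k)‖ ≤ 1 + 1 / Δ := by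
      have hm : ∀ k ∈ Ico a' b', k ∈ Ico a b ∧ (m : ℝ) ≤ D k ∧ D k < m + 1 ∧ m + Δ ≤ D k ∧
        D k ≤ m + 1 - Δ := fun k hk => (hF₃mem k).1 (he ▸ hk)
      rw [he]
      refine norm_sum_expTwoPi_le_of_monotone_diff hΔ m (fun k hk => (hm k hk).2.2.2.1)
        (fun k hk => (hm k hk).2.2.2.2) fun k h1 h2 => ?_
      have h3 := mem_Ico.1 (hm k (mem_Ico.2 ⟨h1, by omega⟩)).1
      have h4 := mem_Ico.1 (hm (k + 1) (mem_Ico.2 ⟨by omega, h2⟩)).1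
      exact hDmono k (k + 1) h3.1 (by omega) h4.2
    refine (norm_add_le _ _).trans ?_
    have := norm_add_le (∑ k ∈ F₂, expTwoPi (f k)) (∑ k ∈ F₃, expTwoPi (f k))
    have := hnormcard F₁
    have := hnormcard F₂
    linarith
  have hmaps : ∀ k ∈ Ico a b, ⌊D k⌋ ∈ Icc ⌊D a⌋ ⌊D (b - 1)⌋ := by
    intro k hk
    rw [mem_Ico] at hk
    rw [mem_Icc]
    exact ⟨Int.floor_le_floor (hDmono a k le_rfl hk.1 hk.2),
      Int.floor_le_floor (hDmono k (b - 1) hk.1 (by omega) (by omega))⟩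
  rw [← sum_fiberwise_of_maps_to hmaps]
  refine (norm_sum_le _ _).trans ((sum_le_sum fun m _ => hfiber m).trans ?_)
  rw [sum_const, nsmul_eq_mul]
  refine mul_le_mul_of_nonneg_right ?_ (by positivity)
  have hle : ⌊D a⌋ ≤ ⌊D (b - 1)⌋ := Int.floor_le_floor
    (hDmono a (b - 1) le_rfl (by omega) (by omega))
  have h1 : ((#(Icc ⌊D a⌋ ⌊D (b - 1)⌋) : ℕ) : ℝ) = ⌊D (b - 1)⌋ + 1 - ⌊D a⌋ := by
    have : ((#(Icc ⌊D a⌋ ⌊D (b - 1)⌋) : ℕ) : ℤ) = ⌊D (b - 1)⌋ + 1 - ⌊D a⌋ := by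
      rw [Int.card_Icc, Int.toNat_of_nonneg (by omega)]
    exact_mod_cast this
  rw [h1]
  have h2 := Int.floor_le (D (b - 1))
  have h3 := Int.lt_floor_add_one (D a)
  have h4 := hDhi a le_rfl (b - 1) (by omega) (by omega)
  rw [Nat.cast_sub (by omega)] at h4
  push_cast at h4
  nlinarith

/-- The mean value theorem twice: for `(y + 1)^α - y^α`, then for the power `α - 1`. -/
theorem exists_second_diff_rpow {α : ℝ} {t : ℝ} (ht : 0 < t) :
    ∃ η, t < η ∧ η < t + 2 ∧
      ((t + 1 + 1) ^ α - (t + 1) ^ α) - ((t + 1) ^ α - t ^ α) = α * (α - 1) * η ^ (α - 2) := by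
  have hder : ∀ s : ℝ, 0 < s → ∀ p : ℝ, HasDerivAt (fun y : ℝ => y ^ p) (p * s ^ (p - 1)) s :=
    fun s hs p => Real.hasDerivAt_rpow_const (Or.inl hs.ne')
  have hder1 : ∀ s : ℝ, 0 < s → HasDerivAt (fun y : ℝ => (y + 1) ^ α - y ^ α)
      (α * (s + 1) ^ (α - 1) - α * s ^ (α - 1)) s := by
    intro s hs
    exact ((hder (s + 1) (by linarith) α).comp_add_const s 1).sub (hder s hs α)
  obtain ⟨ξ, hξ, h1⟩ := exists_hasDerivAt_eq_slope (fun y : ℝ => (y + 1) ^ α - y ^ α)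
    (fun s => α * (s + 1) ^ (α - 1) - α * s ^ (α - 1)) (show t < t + 1 by linarith)
    (fun s hs => (hder1 s (by linarith [hs.1])).continuousAt.continuousWithinAt)
    (fun s hs => hder1 s (by linarith [hs.1]))
  obtain ⟨η, hη, h2⟩ := exists_hasDerivAt_eq_slope (fun y : ℝ => y ^ (α - 1))
    (fun s => (α - 1) * s ^ (α - 1 - 1)) (show ξ < ξ + 1 by linarith)
    (fun s hs => (hder s (by linarith [hs.1, hξ.1]) _).continuousAt.continuousWithinAt)
    (fun s hs => hder s (by linarith [hs.1, hξ.1]) _)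
  refine ⟨η, by linarith [hη.1, hξ.1], by linarith [hη.2, hξ.2], ?_⟩
  rw [add_sub_cancel_left, div_one] at h1 h2
  rw [show α - 1 - 1 = α - 2 by ring] at h2
  rw [← h1, mul_assoc, h2]
  ring

theorem abs_sum_sin_rpow_le {α : ℝ} (hα0 : 0 < α) (hα2 : α < 2) (hα1 : α ≠ 1) {x : ℝ}
    (hx : x ≠ 0) {j a b : ℕ} (ha : 2 ^ j ≤ a) (hab : a ≤ b) (hb : b ≤ 2 ^ (j + 1)) {L : ℝ}
    (hL : L = |x| * (α * |α - 1| / (2 * Real.pi)) * ((2 : ℝ) ^ j) ^ (α - 2)) :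
    |∑ k ∈ Ico a b, Real.sin ((k : ℝ) ^ α * x)| ≤ (2 ^ j * L + 2) * (6 / √L + 3) := by
  have hpi := Real.pi_pos
  have hα1' : 0 < |α - 1| := abs_pos.2 (sub_ne_zero.2 hα1)
  have hx' : 0 < |x| := abs_pos.2 hx
  have hN : (0 : ℝ) < 2 ^ j := by positivity
  have hL0 : 0 < L := by rw [hL]; positivity
  -- The sign `s` makes the second differences of the phase positive; it only changes the sign of
  -- the sine sum.
  obtain ⟨s, hs, hsx⟩ : ∃ s : ℝ, (s = 1 ∨ s = -1) ∧ s * (x * (α - 1)) = |x| * |α - 1| := by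
    rw [← abs_mul]
    rcases abs_choice (x * (α - 1)) with h | h
    · exact ⟨1, Or.inl rfl, by rw [h, one_mul]⟩
    · exact ⟨-1, Or.inr rfl, by rw [h]; ring⟩
  set f : ℕ → ℝ := fun k => s * x / (2 * Real.pi) * (k : ℝ) ^ α with hf
  have hsum : |∑ k ∈ Ico a b, Real.sin ((k : ℝ) ^ α * x)|
      ≤ ‖∑ k ∈ Ico a b, expTwoPi (f k)‖ := by
    refine le_trans (le_of_eq ?_) (abs_sum_sin_le_norm_sum_expTwoPi (Ico a b) f)
    have e : ∀ k : ℕ, 2 * Real.pi * f k = s * ((k : ℝ) ^ α * x) := by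
      intro k; rw [hf]; field_simp
    simp only [e]
    rcases hs with rfl | rfl
    · simp
    · simp [sum_neg_distrib]
  have hsecond : ∀ k, a ≤ k → k + 1 < b →
      L / 4 ≤ (f (k + 1 + 1) - f (k + 1)) - (f (k + 1) - f k) ∧
      (f (k + 1 + 1) - f (k + 1)) - (f (k + 1) - f k) ≤ L := by
    intro k hk1 hk2
    have hk : (2 : ℝ) ^ j ≤ k := by exact_mod_cast ha.trans hk1
    have hk' : (k : ℝ) + 2 ≤ 2 * 2 ^ j := by
      rw [pow_succ'] at hb
      exact_mod_cast (by omega : k + 2 ≤ 2 * 2 ^ j)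
    obtain ⟨η, h1, h2, h3⟩ := exists_second_diff_rpow (α := α) (t := (k : ℝ)) (by linarith)
    have e : (f (k + 1 + 1) - f (k + 1)) - (f (k + 1) - f k)
        = |x| * (α * |α - 1| / (2 * Real.pi)) * η ^ (α - 2) := by
      rw [hf]
      push_cast
      calc _ = s * x / (2 * Real.pi)
            * (((k : ℝ) + 1 + 1) ^ α - ((k : ℝ) + 1) ^ α - (((k : ℝ) + 1) ^ α - (k : ℝ) ^ α)) := by
              ring
        _ = s * (x * (α - 1)) * α / (2 * Real.pi) * η ^ (α - 2) := by rw [h3]; ring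
        _ = _ := by rw [hsx]; ring
    have hup : η ^ (α - 2) ≤ ((2 : ℝ) ^ j) ^ (α - 2) :=
      Real.rpow_le_rpow_of_nonpos hN (by linarith) (by linarith)
    have hdown : ((2 : ℝ) ^ j) ^ (α - 2) / 4 ≤ η ^ (α - 2) := by
      have h4 : (2 * (2 : ℝ) ^ j) ^ (α - 2) ≤ η ^ (α - 2) :=
        Real.rpow_le_rpow_of_nonpos (by linarith) (by linarith) (by linarith)
      refine le_trans ?_ h4
      rw [Real.mul_rpow (by norm_num) hN.le]
      have h5 : (1 / 4 : ℝ) ≤ 2 ^ (α - 2) := by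
        calc (1 / 4 : ℝ) = 2 ^ (-2 : ℝ) := by
              rw [Real.rpow_neg (by norm_num)]; norm_num
          _ ≤ _ := Real.rpow_le_rpow_of_exponent_le (by norm_num) (by linarith)
      have : 0 < ((2 : ℝ) ^ j) ^ (α - 2) := by positivity
      nlinarith
    have hκ : 0 ≤ |x| * (α * |α - 1| / (2 * Real.pi)) := by positivity
    rw [e, hL]
    constructor
    · rw [mul_div_assoc]
      exact mul_le_mul_of_nonneg_left hdown hκ
    · exact mul_le_mul_of_nonneg_left hup hκ
  have hsq : 0 < √L := Real.sqrt_pos.2 hL0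
  -- `Δ = √L / 2` makes `Δ / lam` and `1 / Δ` both equal to `2 / √L`.
  have h1 := norm_sum_expTwoPi_le_of_second_diff (f := f) hab (lam := L / 4) (μ := L)
    (Δ := √L / 2) (by linarith) hL0.le (by linarith)
    (fun k h1 h2 => (hsecond k h1 h2).1) (fun k h1 h2 => (hsecond k h1 h2).2)
  refine hsum.trans (h1.trans ?_)
  have hba : (b : ℝ) - a ≤ 2 ^ j := by
    have h2 : (b : ℝ) ≤ 2 * 2 ^ j := by rw [pow_succ'] at hb; exact_mod_cast hb
    have h3 : (2 : ℝ) ^ j ≤ a := by exact_mod_cast ha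
    linarith
  have e : 2 * (√L / 2 / (L / 4) + 1) + (1 + 1 / (√L / 2)) = 6 / √L + 3 := by
    have h2 : √L / 2 / (L / 4) = 2 / √L := by
      have h3 := Real.mul_self_sqrt hL0.le
      rw [div_div_eq_mul_div, div_eq_div_iff hL0.ne' hsq.ne']
      linear_combination 2 * h3
    rw [h2]; field_simp; ring
  rw [e]
  gcongr

-- With `T j = √|x| * 2^(jα/2)`, the normalised sums are at most `2 * T j`, as `|sin y| ≤ min 1
-- |y|`. The second derivative test gives a multiple of `(T j)⁻¹` plus a term of ratio `R / 2`,
-- which is summable because `α < 2`.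
set_option maxHeartbeats 800000 in
theorem exists_dyadicSineBound_of_bounded {α : ℝ} (hα0 : 0 < α) (hα2 : α < 2) (hα1 : α ≠ 1)
    (B : ℝ) : ∃ A : ℝ, ∀ x : ℝ, |x| ≤ B →
    ∃ σ, DyadicSineBound α x σ ∧ ∀ J, ∑ j ∈ range J, σ j ≤ A := by
  have hpi := Real.pi_pos
  have hα1' : 0 < |α - 1| := abs_pos.2 (sub_ne_zero.2 hα1)
  set κ := α * |α - 1| / (2 * Real.pi) with hκ
  have hκ0 : 0 < κ := by positivity
  have hsκ : 0 < √κ := Real.sqrt_pos.2 hκ0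
  set R : ℝ := 2 ^ (α / 2) with hR
  have hR1 : 1 < R := Real.one_lt_rpow (by norm_num) (by linarith)
  have hR2 : R < 2 := by
    calc R < 2 ^ (1 : ℝ) := Real.rpow_lt_rpow_of_exponent_lt (by norm_num) (by linarith)
      _ = 2 := Real.rpow_one 2
  have hR0 : 0 < R := by linarith
  set E : ℝ := 6 + 3 * (√κ * √B) with hE
  have hE0 : 0 < E := by positivity
  set c₁ : ℝ := E * (√κ * √B) with hc₁
  set c₂ : ℝ := 2 * E / √κ with hc₂
  have hc₁0 : 0 ≤ c₁ := by positivity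
  have hc₂0 : 0 < c₂ := by positivity
  refine ⟨c₁ * (1 - R / 2)⁻¹ + (c₂ + 2) * (2 * (1 + R) / (R - 1)), fun x hxB => ?_⟩
  set T : ℕ → ℝ := fun j => √|x| * R ^ j with hT
  refine ⟨fun j => c₁ * (R / 2) ^ j + (c₂ + 2) * min (T j) (T j)⁻¹, ?_, fun J => ?_⟩
  · intro j a b ha hab hb
    have hT0 : 0 ≤ T j := by positivity
    have hmin0 : 0 ≤ min (T j) (T j)⁻¹ := le_min hT0 (inv_nonneg.2 hT0)
    rcases eq_or_ne x 0 with rfl | hx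
    · have h0 : 0 ≤ c₁ * (R / 2) ^ j := by positivity
      have h1 : 0 ≤ (c₂ + 2) * min (T j) (T j)⁻¹ := mul_nonneg (by linarith) hmin0
      simp only [mul_zero, Real.sin_zero, sum_const_zero, abs_zero]
      positivity
    have hx' : 0 < |x| := abs_pos.2 hx
    have hsx : 0 < √|x| := Real.sqrt_pos.2 hx'
    have hTpos : 0 < T j := by positivity
    set N : ℝ := 2 ^ j with hN
    have hN0 : 0 < N := by positivity
    set S := |∑ k ∈ Ico a b, Real.sin ((k : ℝ) ^ α * x)| with hS
    have hRj : R ^ j = N ^ (α / 2) := by rw [hR, hN, Real.rpow_pow_comm (by norm_num)]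
    have hNα : N ^ α = (R ^ j) ^ 2 := by
      rw [hRj, ← Real.rpow_natCast, ← Real.rpow_mul hN0.le]; congr 1; push_cast; ring
    have hTsq : T j ^ 2 = |x| * N ^ α := by
      rw [hT, mul_pow, Real.sq_sqrt hx'.le, hNα]
    have hS1 : S ≤ N := abs_sum_sin_le_two_pow (fun k : ℕ => (k : ℝ) ^ α * x) ha hb
    have hS2 : S ≤ N * (4 * T j ^ 2) := by
      have h1 : ∀ k ∈ Ico a b, |Real.sin ((k : ℝ) ^ α * x)| ≤ 4 * T j ^ 2 := by
        intro k hk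
        rw [mem_Ico] at hk
        have hk2 : (k : ℝ) ≤ 2 * N := by
          have : k ≤ 2 ^ (j + 1) := by omega
          rw [pow_succ'] at this
          rw [hN]; exact_mod_cast this
        refine Real.abs_sin_le_abs.trans ?_
        rw [abs_mul, abs_of_nonneg (by positivity), hTsq]
        have h2 : (k : ℝ) ^ α ≤ 4 * N ^ α := by
          calc (k : ℝ) ^ α ≤ (2 * N) ^ α := by gcongr
            _ = 2 ^ α * N ^ α := Real.mul_rpow (by norm_num) hN0.le
            _ ≤ 2 ^ (2 : ℝ) * N ^ α := by
              gcongr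
              norm_num
            _ = 4 * N ^ α := by norm_num
        nlinarith
      calc S ≤ ∑ k ∈ Ico a b, |Real.sin ((k : ℝ) ^ α * x)| := abs_sum_le_sum_abs _ _
        _ ≤ ∑ k ∈ Ico a b, 4 * T j ^ 2 := sum_le_sum h1
        _ = ((b - a : ℕ) : ℝ) * (4 * T j ^ 2) := by simp
        _ ≤ N * (4 * T j ^ 2) := by
          gcongr
          rw [pow_succ] at hb
          rw [hN]; exact_mod_cast (by omega : b - a ≤ 2 ^ j)
    have hS3 : S ≤ N * (2 * T j) := by
      rcases le_total (2 * T j) 1 with h | h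
      · refine hS2.trans (mul_le_mul_of_nonneg_left ?_ hN0.le)
        nlinarith
      · nlinarith
    set L := |x| * κ * N ^ (α - 2) with hL
    have hL0 : 0 < L := by positivity
    have hS4 := abs_sum_sin_rpow_le hα0 hα2 hα1 hx ha hab hb (L := L) rfl
    have hsL : √L = √κ * (T j / N) := by
      rw [Real.sqrt_eq_iff_mul_self_eq hL0.le (by positivity), eq_comm]
      have h1 : N ^ (α - 2) = N ^ α / N ^ 2 := by
        rw [Real.rpow_sub hN0]; norm_num
      calc √κ * (T j / N) * (√κ * (T j / N)) = (√κ * √κ) * (T j ^ 2 / N ^ 2) := by ring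
        _ = κ * (|x| * N ^ α / N ^ 2) := by rw [Real.mul_self_sqrt hκ0.le, hTsq]
        _ = L := by rw [hL, h1]; ring
    have hsL0 : 0 < √L := Real.sqrt_pos.2 hL0
    have hTN : T j / N = √|x| * (R / 2) ^ j := by
      rw [hT, hN, div_pow]; ring
    have hsLB : √L ≤ √κ * √B * (R / 2) ^ j := by
      rw [hsL, hTN, ← mul_assoc]
      gcongr
    have hsLB' : √L ≤ √κ * √B := by
      refine hsLB.trans (mul_le_of_le_one_right (by positivity) ?_)
      exact pow_le_one₀ (by positivity) (by linarith)
    have hS5 : S ≤ N * (c₁ * (R / 2) ^ j + c₂ * (T j)⁻¹) := by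
      have h1 : 6 / √L + 3 ≤ E / √L := by
        rw [le_div_iff₀ hsL0, add_mul, div_mul_cancel₀ _ hsL0.ne']
        rw [hE]; linarith
      have hLs : L = √L * √L := (Real.mul_self_sqrt hL0.le).symm
      calc S ≤ (N * L + 2) * (6 / √L + 3) := hS4
        _ ≤ (N * L + 2) * (E / √L) := by gcongr
        _ = N * (E * √L) + 2 * E / √L := by
          nth_rewrite 1 [hLs]; field_simp
        _ ≤ N * (E * (√κ * √B * (R / 2) ^ j)) + 2 * E / √L := by gcongr
        _ = N * (c₁ * (R / 2) ^ j + c₂ * (T j)⁻¹) := by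
          rw [hsL, hc₁, hc₂]; field_simp
    have h0 : 0 ≤ c₁ * (R / 2) ^ j := by positivity
    have hmain : S ≤ N * (c₁ * (R / 2) ^ j + (c₂ + 2) * min (T j) (T j)⁻¹) := by
      rcases min_choice (T j) (T j)⁻¹ with h | h <;> rw [h]
      · refine hS3.trans (mul_le_mul_of_nonneg_left ?_ hN0.le)
        have := mul_nonneg hc₂0.le hT0
        linarith
      · refine hS5.trans (mul_le_mul_of_nonneg_left ?_ hN0.le)
        have := inv_nonneg.2 hT0
        linarith
    rw [mul_comm N] at hmain
    exact hmain
  · rw [sum_add_distrib, ← mul_sum, ← mul_sum]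
    refine add_le_add ?_ ?_
    · exact mul_le_mul_of_nonneg_left
        (sum_geometric_le (by positivity) (by linarith) J) hc₁0
    · exact mul_le_mul_of_nonneg_left
        (sum_min_geometric_le (Real.sqrt_nonneg _) hR1 J) (by linarith)

end DyadicBounds

theorem theorem2 (c : ℕ → ℝ) (hnonneg : ∀ k : ℕ, 1 ≤ k → 0 ≤ c k)
    (hanti : ∀ k : ℕ, 1 ≤ k → c (k + 1) ≤ c k) :
    (∀ n : ℕ, 0 < n → Even n → ∀ X : Set ℝ,
      (∃ m : ℤ, Real.pi / 2 + 2 * Real.pi * (m : ℝ) ∈ X ∨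
        2 * Real.pi / 3 + 2 * Real.pi * (m : ℝ) ∈ X) →
      (SineSeriesConvergesUniformlyOn c (n : ℝ) X ↔ Summable (fun k : ℕ => c (k + 1)))) ∧
    (∀ n : ℕ, Odd n → ∀ X : Set ℝ,
      ContainsDiscreteNeighbourhoodOfZero (n : ℝ) X →
      (SineSeriesConvergesUniformlyOn c (n : ℝ) X ↔
        Filter.Tendsto (fun k : ℕ => c k * (k : ℝ)) Filter.atTop (nhds 0))) ∧
    (∀ α : ℝ, 0 < α → α < 2 → ∀ X : Set ℝ, Bornology.IsBounded X →
      ContainsDiscreteNeighbourhoodOfZero α X →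
      (SineSeriesConvergesUniformlyOn c α X ↔
        Filter.Tendsto (fun k : ℕ => c k * (k : ℝ)) Filter.atTop (nhds 0))) := by
  refine ⟨fun n hn he X hX => ⟨summable_of_convergesUniformlyOn_even hnonneg hanti hn he hX,
      fun h => convergesUniformlyOn_of_summable hnonneg h _ _⟩,
    fun n hn X hX => ⟨tendsto_of_convergesUniformlyOn hnonneg hanti
      (by exact_mod_cast hn.pos) hX, fun h => ?_⟩,
    fun α hα0 hα2 X hXb hX => ⟨tendsto_of_convergesUniformlyOn hnonneg hanti hα0 hX,
      fun h => ?_⟩⟩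
  · obtain ⟨A, hA⟩ := exists_dyadicSineBound_odd hn
    exact convergesUniformlyOn_of_dyadicSineBound hnonneg hanti (fun x _ => hA x) h
  -- For `α = 1` the second differences vanish, so the odd case with exponent `1` is used instead.
  · by_cases hα1 : α = 1
    · obtain ⟨A, hA⟩ := exists_dyadicSineBound_odd odd_one
      rw [Nat.cast_one, ← hα1] at hA
      exact convergesUniformlyOn_of_dyadicSineBound hnonneg hanti (fun x _ => hA x) h
    · obtain ⟨B, hB⟩ := hXb.exists_norm_le
      obtain ⟨A, hA⟩ := exists_dyadicSineBound_of_bounded hα0 hα2 hα1 B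
      exact convergesUniformlyOn_of_dyadicSineBound hnonneg hanti
        (fun x hx => hA x (by simpa using hB x hx)) h
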